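/- Let $\Omega\subset\mathbb R^2$ be a closed set with $C^\infty$ boundary (near each boundary point, $\Omega=\{f\ge 0\}$ for a smooth function $f$ with $\nabla f\neq 0$) and assume that $\partial\Omega$ is compact. Let $\mathbf n(x)$ be the inward unit normal at $x\in\partial\Omega$, and let $K(x)$ be the curvature of $\partial\Omega$, defined by $\mathbf x''=K\,\mathbf n$ for unit speed parametrizations $\mathbf x$ of $\partial\Omega$ (so $K<0$ where the boundary is strictly concave). Let $$M^\circ=\{(x,w): x\in\partial\Omega,\ w\in\mathbb R^2,\ |w|=1,\ \langle w,\mathbf n(x)\rangle>0\},$$ a smooth surface embedded in $\mathbb R^2\times\mathbb R^2$. The billiard ball map $\varphi$ sends $(x_1,w_1)\in M^\circ$ to $(x_2,w_2)\in M^\circ$, where $x_2$ is the first intersection of $\partial\Omega$ with the ray $\{x_1+tw_1: t>0\}$ and $w_2=w_1-2\langle w_1,\mathbf n(x_2)\rangle\mathbf n(x_2)$; it is defined on the set $D\subset M^\circ$ of those points for which the ray meets $\partial\Omega$ and its first intersection with $\partial\Omega$ is not glancing. Let $\mathcal K\subset D$ be a compact set such that $\varphi(\mathcal K)=\mathcal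 K$, and assume that $K(x)<0$ for all $(x,w)\in\mathcal K$. Then $\varphi$ is hyperbolic on $\mathcal K$. That is: $\varphi$ is injective on $D$; $D$ and $\varphi(D)$ contain neighborhoods of $\mathcal K$ in $M^\circ$; $\varphi$ and $\varphi^{-1}$ are smooth near $\mathcal K$; and for each $\rho\in\mathcal K$ there is a splitting $T_\rho M^\circ=E_u(\rho)\oplus E_s(\rho)$ into one-dimensional subspaces such that $d\varphi(\rho)E_u(\rho)=E_u(\varphi(\rho))$ and $d\varphi(\rho)E_s(\rho)=E_s(\varphi(\rho))$ for all $\rho\in\mathcal K$, and, for some Riemannian metric $|\cdot|$ on $M^\circ$ and some constants $C>0$, $0<\lambda<1$, $$|d\varphi^{-n}(\rho)v|\le C\lambda^n|v|\ \ (v\in E_u(\rho)),\qquad |d\varphi^{n}(\rho)v|\le C\lambda^n|v|\ \ (v\in E_s(\rho))$$ for all $\rho\in\mathcal K$ and all integers $n\ge 0$. -/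

import Mathlib

open scoped ContDiff Topology

/-! ### Hyperbolic sets of smooth maps on embedded submanifolds -/

section Hyperbolic

variable {V : Type*} [NormedAddCommGroup V] [NormedSpace ℝ V]

/-- The tangent space `T_x M` of a smooth submanifold `M` (without boundary) embedded in `V`.
For such `M` the tangent cone is already a linear subspace. -/
def embTangentSpace (M : Set V) (x : V) : Submodule ℝ V :=
  Submodule.span ℝ (tangentConeAt ℝ M x)

/-- `g` is a (smooth) Riemannian metric on the embedded submanifold `M`: for each `x ∈ M` the
bilinear form `g x` restricts to an inner product on `T_x M`. -/
structure IsRiemannianMetricOn (M : Set V) (g : V → V →L[ℝ] V →L[ℝ] ℝ) : Prop where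
  smooth : ContDiffOn ℝ ∞ g M
  symm : ∀ x ∈ M, ∀ u ∈ embTangentSpace M x, ∀ v ∈ embTangentSpace M x, g x u v = g x v u
  pos : ∀ x ∈ M, ∀ v ∈ embTangentSpace M x, v ≠ 0 → 0 < g x v v

/-- Let `M` be an embedded submanifold of `V` and `φ` a map from `D ⊆ M` to `M` (the values of `φ`
off `D` are irrelevant). `IsHyperbolicOn M D φ du ds K` says that the compact set `K ⊆ D` satisfies
`φ(K) = K`, that near `K` the map `φ` is a smooth diffeomorphism between relatively open subsets
of `M`, and that `φ` is hyperbolic on `K`, with unstable dimension `du` and stable dimension `ds`.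

The inverse `φ⁻¹` is `Function.invFunOn φ D`. Differentials of maps of `M` are derivatives within
`M`; on vectors of `T_x M`, the only ones to which they are applied, these do not depend on
choices. -/
structure IsHyperbolicOn (M D : Set V) (φ : V → V) (du ds : ℕ) (K : Set V) : Prop where
  isCompact : IsCompact K
  subset_domain : K ⊆ D
  domain_subset : D ⊆ M
  mapsTo : Set.MapsTo φ D M
  image_eq : φ '' K = K
  injOn : Set.InjOn φ D
  domain_mem_nhds : ∀ x ∈ K, D ∈ 𝓝[M] x
  image_mem_nhds : ∀ x ∈ K, φ '' D ∈ 𝓝[M] x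
  smooth : ∀ x ∈ K, ContDiffWithinAt ℝ ∞ φ M x
  smooth_inv : ∀ x ∈ K, ContDiffWithinAt ℝ ∞ (Function.invFunOn φ D) M x
  /-- the splitting, its invariance, and the two contraction properties -/
  splitting : ∃ Eu Es : V → Submodule ℝ V,
    (∀ x ∈ K, Eu x ⊔ Es x = embTangentSpace M x ∧ Disjoint (Eu x) (Es x) ∧
      Module.finrank ℝ (Eu x) = du ∧ Module.finrank ℝ (Es x) = ds) ∧
    (∀ x ∈ K, (Eu x).map (fderivWithin ℝ φ M x : V →ₗ[ℝ] V) = Eu (φ x) ∧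
      (Es x).map (fderivWithin ℝ φ M x : V →ₗ[ℝ] V) = Es (φ x)) ∧
    ∃ (g : V → V →L[ℝ] V →L[ℝ] ℝ) (C r : ℝ), IsRiemannianMetricOn M g ∧
      0 < C ∧ 0 < r ∧ r < 1 ∧
      (∀ x ∈ K, ∀ v ∈ Eu x, ∀ n : ℕ,
        let y := (Function.invFunOn φ D)^[n] x
        let w := fderivWithin ℝ ((Function.invFunOn φ D)^[n]) M x v
        √(g y w w) ≤ C * r ^ n * √(g x v v)) ∧
      (∀ x ∈ K, ∀ v ∈ Es x, ∀ n : ℕ,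
        let y := φ^[n] x
        let w := fderivWithin ℝ (φ^[n]) M x v
        √(g y w w) ≤ C * r ^ n * √(g x v v))

end Hyperbolic

/-! ### Planar billiards -/

namespace Billiard

/-- The Euclidean plane. -/
abbrev Plane : Type := EuclideanSpace ℝ (Fin 2)

/-- `f` is a smooth function, regular at `p`, with `Ω = {f ≥ 0}` near `p`. -/
structure IsLocalDefiningFunction (Ω : Set Plane) (p : Plane) (f : Plane → ℝ) : Prop where
  smooth : ContDiff ℝ ∞ f
  gradient_ne_zero : gradient f p ≠ 0
  mem_iff : ∀ᶠ y in 𝓝 p, y ∈ Ω ↔ 0 ≤ f y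

/-- `Ω` has a smooth boundary: near each boundary point it is a regular superlevel set of a smooth
function. (Such a set is closed; it is not required to be bounded or connected.) -/
def HasSmoothBoundary (Ω : Set Plane) : Prop :=
  ∀ p ∈ frontier Ω, ∃ f : Plane → ℝ, IsLocalDefiningFunction Ω p f

/-- `ν` is the unit normal of `∂Ω` at `p` that points into `Ω`. -/
def IsInwardUnitNormal (Ω : Set Plane) (p ν : Plane) : Prop :=
  ∃ f : Plane → ℝ, IsLocalDefiningFunction Ω p f ∧ ν = ‖gradient f p‖⁻¹ • gradient f p

open Classical in
/-- The inward unit normal `n(p)`, for `p ∈ ∂Ω` (it does not depend on the choice of the defining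
function). -/
noncomputable def inwardNormal (Ω : Set Plane) (p : Plane) : Plane :=
  if h : ∃ ν, IsInwardUnitNormal Ω p ν then h.choose else 0

/-- `k` is the curvature of `∂Ω` at `p` with respect to the inward normal: if `γ` is a unit speed
parametrization of `∂Ω` near `p = γ 0`, with velocity `γ'`, then `γ''(0) = k n(p)`. (Reversing the
orientation of `γ` does not change `γ''(0)`.) -/
def IsBoundaryCurvature (Ω : Set Plane) (p : Plane) (k : ℝ) : Prop :=
  ∃ γ : ℝ → Plane, ContDiff ℝ ∞ γ ∧ γ 0 = p ∧
    (∀ᶠ θ in 𝓝 (0 : ℝ), γ θ ∈ frontier Ω ∧ ‖deriv γ θ‖ = 1) ∧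
    deriv (deriv γ) 0 = k • inwardNormal Ω p

open Classical in
/-- The curvature `K(p)` of `∂Ω` at `p ∈ ∂Ω`. -/
noncomputable def boundaryCurvature (Ω : Set Plane) (p : Plane) : ℝ :=
  if h : ∃ k, IsBoundaryCurvature Ω p k then h.choose else 0

/-- The interior `M°` of the phase space: pairs `(x, w)` of a boundary point and a unit vector that
points strictly into `Ω`. -/
def phaseInterior (Ω : Set Plane) : Set (Plane × Plane) :=
  {p | p.1 ∈ frontier Ω ∧ ‖p.2‖ = 1 ∧ 0 < inner ℝ p.2 (inwardNormal Ω p.1)}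

/-- One bounce: `q.1` is the first intersection of `∂Ω` with the open ray from `p.1` in direction
`p.2`, and `q.2` is `p.2` reflected in the tangent line at `q.1`; both ends are non-glancing. -/
def IsBounce (Ω : Set Plane) (p q : Plane × Plane) : Prop :=
  p ∈ phaseInterior Ω ∧ q ∈ phaseInterior Ω ∧
    (∃ t : ℝ, 0 < t ∧ q.1 = p.1 + t • p.2 ∧
      ∀ s ∈ Set.Ioo 0 t, p.1 + s • p.2 ∉ frontier Ω) ∧
    q.2 = p.2 - (2 * inner ℝ p.2 (inwardNormal Ω q.1)) • inwardNormal Ω q.1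

/-- The points of `M°` at which the billiard ball map is defined. -/
def billiardDomain (Ω : Set Plane) : Set (Plane × Plane) :=
  {p | ∃ q, IsBounce Ω p q}

open Classical in
/-- The billiard ball map (extended by the identity off its domain). -/
noncomputable def billiardMap (Ω : Set Plane) (p : Plane × Plane) : Plane × Plane :=
  if h : ∃ q, IsBounce Ω p q then h.choose else p

end Billiard

/-! This is the cone argument for dispersing billiards. A variation of an outgoing ray has
coordinates `(J, J')`: its displacement `J` across the ray and its rate of rotation `J'`. Free
flight over length `t` sends them to `(J + t J', J')`. Reflection off a wall of curvature `K` sends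
them to `-(J, J' + a J)`, where `a = -2K / ⟨w, n⟩` and `w` is the outgoing direction. So in the
frame `frameBase`, `frameAngle` the differential is `-!![1, t; a, 1 + t * a]`
(`IsBounce.fderivWithin_frame`), and `K < 0` makes every entry of the matrix without its sign
positive.

On slopes `y = J'/J` the map acts by `y ↦ a + y / (1 + t y)`, which is increasing and bounded on
`[0, ∞)`. Iterating from slope `0` along the past gives an invariant slope `u`; iterating the
inverse along the future gives an invariant slope `-s ≤ 0` (`exists_invariant_section`). The first
line is stretched by `1 + t u`, the second shrunk by `1 / (1 + t (s + a))` with `s`, `a` taken at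
the image point. On the compact set, `t` and `a` are bounded below by positive constants, so both
rates are uniform (`exists_splitting_of_dispersing`). No continuity of the slopes is needed.

Smoothness comes from the implicit function theorem at transversal hits, together with a compactness
argument excluding earlier hits (`IsBounce.exists_smooth_extension`). Injectivity and smoothness of
the inverse follow by time reversal. -/

open Filter Set

/-! ### Tangent vectors of embedded sets -/

section TangentSpace

variable {V : Type*} [NormedAddCommGroup V] [NormedSpace ℝ V]

/-- Two derivatives within `M` agree on the tangent space. -/
theorem HasFDerivWithinAt.eqOn_embTangentSpace {W : Type*} [NormedAddCommGroup W]
    [NormedSpace ℝ W] {M : Set V} {x : V} {f : V → W} {L L' : V →L[ℝ] W}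
    (h : HasFDerivWithinAt f L M x) (h' : HasFDerivWithinAt f L' M x) :
    EqOn L L' (embTangentSpace M x) := fun _ hv =>
  LinearMap.eqOn_span (f := (L : V →ₗ[ℝ] W)) (g := (L' : V →ₗ[ℝ] W)) (h.unique_on h') hv

/-- A function that is constant on `M` near `x` has a derivative that kills the tangent space. -/
theorem HasFDerivWithinAt.eq_zero_of_eventually_const {W : Type*} [NormedAddCommGroup W]
    [NormedSpace ℝ W] {M : Set V} {x : V} {f : V → W} {L : V →L[ℝ] W} {c : W}
    (h : HasFDerivWithinAt f L M x) (hc : ∀ᶠ y in 𝓝[M] x, f y = c) (hx : f x = c)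
    {v : V} (hv : v ∈ embTangentSpace M x) : L v = 0 :=
  h.eqOn_embTangentSpace
    ((hasFDerivWithinAt_const c x M).congr_of_eventuallyEq hc hx) hv

/-- The velocity of a curve in `M` is a tangent vector. -/
theorem HasDerivAt.mem_embTangentSpace {M : Set V} {x v : V} {γ : ℝ → V}
    (h : HasDerivAt γ v 0) (hx : γ 0 = x) (hγ : ∀ᶠ s in 𝓝 (0 : ℝ), γ s ∈ M) :
    v ∈ embTangentSpace M x := by
  have h1 := (h.hasFDerivAt.hasFDerivWithinAt (s := {s | γ s ∈ M})).mapsTo_tangent_cone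
  rw [tangentConeAt_of_mem_nhds hγ, hx] at h1
  have h2 := h1 (mem_univ (1 : ℝ))
  simp only [ContinuousLinearMap.toSpanSingleton_apply, one_smul] at h2
  exact Submodule.subset_span (tangentConeAt_mono (by rintro _ ⟨s, hs, rfl⟩; exact hs) h2)

end TangentSpace

/-! ### Contraction along invariant line fields -/

section Contraction

variable {V : Type*} [NormedAddCommGroup V] [NormedSpace ℝ V]

/-- An invariant vector field that is scaled by factors of modulus at most `r` is scaled by
factors of modulus at most `r ^ n` under the `n`-th iterate. -/
theorem exists_hasFDerivWithinAt_iterate {M K : Set V} {φ : V → V} {e : V → V} {m : V → ℝ} {r : ℝ}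
    (hr : 0 ≤ r) (hmaps : MapsTo φ K K) (hM : ∀ x ∈ K, ∀ᶠ y in 𝓝[M] x, φ y ∈ M)
    (hd : ∀ x ∈ K, DifferentiableWithinAt ℝ φ M x)
    (he : ∀ x ∈ K, fderivWithin ℝ φ M x (e x) = m x • e (φ x))
    (hm : ∀ x ∈ K, |m x| ≤ r) (n : ℕ) :
    ∀ x ∈ K, ∃ (L : V →L[ℝ] V) (μ : ℝ), HasFDerivWithinAt φ^[n] L M x ∧ |μ| ≤ r ^ n ∧
      L (e x) = μ • e (φ^[n] x) := by
  induction n with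
  | zero =>
    intro x _
    exact ⟨ContinuousLinearMap.id ℝ V, 1, hasFDerivWithinAt_id x M, by simp, by simp⟩
  | succ n ih =>
    intro x hx
    obtain ⟨L, μ, hL, hμ, hLe⟩ := ih (φ x) (hmaps hx)
    refine ⟨L.comp (fderivWithin ℝ φ M x), μ * m x, ?_, ?_, ?_⟩
    · rw [Function.iterate_succ]
      refine hL.comp_of_tendsto x (hd x hx).hasFDerivWithinAt ?_
      exact tendsto_nhdsWithin_iff.2 ⟨(hd x hx).continuousWithinAt, hM x hx⟩
    · rw [abs_mul, pow_succ]
      exact mul_le_mul hμ (hm x hx) (abs_nonneg _) (by positivity)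
    · simp [he x hx, hLe, Function.iterate_succ, smul_smul, mul_comm]

/-- Exponential contraction of an invariant line field, in a norm `√(g x v v)`. -/
theorem contraction_of_invariant_field {M K : Set V} {φ : V → V} {e : V → V} {m : V → ℝ}
    {g : V → V →L[ℝ] V →L[ℝ] ℝ} {r c₀ c₁ : ℝ}
    (hr : 0 ≤ r) (hmaps : MapsTo φ K K) (hM : ∀ x ∈ K, ∀ᶠ y in 𝓝[M] x, φ y ∈ M)
    (hd : ∀ x ∈ K, DifferentiableWithinAt ℝ φ M x)
    (he : ∀ x ∈ K, fderivWithin ℝ φ M x (e x) = m x • e (φ x))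
    (hm : ∀ x ∈ K, |m x| ≤ r) (heT : ∀ x ∈ K, e x ∈ embTangentSpace M x)
    (hc₀ : 0 < c₀) (hg₀ : ∀ x ∈ K, c₀ ≤ √(g x (e x) (e x)))
    (hg₁ : ∀ x ∈ K, √(g x (e x) (e x)) ≤ c₁) {x : V} (hx : x ∈ K) {v : V}
    (hv : v ∈ Submodule.span ℝ {e x}) (n : ℕ) :
    √(g (φ^[n] x) (fderivWithin ℝ (φ^[n]) M x v) (fderivWithin ℝ (φ^[n]) M x v)) ≤
      c₁ / c₀ * r ^ n * √(g x v v) := by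
  obtain ⟨ν, rfl⟩ := Submodule.mem_span_singleton.1 hv
  obtain ⟨L, μ, hL, hμ, hLe⟩ := exists_hasFDerivWithinAt_iterate hr hmaps hM hd he hm n x hx
  -- Derivatives within `M` are determined only on tangent vectors, so `fderivWithin` is compared
  -- with the chain-rule derivative `L` at `e x` alone.
  have h1 : fderivWithin ℝ (φ^[n]) M x (e x) = μ • e (φ^[n] x) := by
    rw [← hLe]
    exact hL.differentiableWithinAt.hasFDerivWithinAt.eqOn_embTangentSpace hL (heT x hx)
  have hs : ∀ (y : V) (α : ℝ) (w : V), √(g y (α • w) (α • w)) = |α| * √(g y w w) := by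
    intro y α w
    have : g y (α • w) (α • w) = α ^ 2 * g y w w := by simp; ring
    rw [this, Real.sqrt_mul (sq_nonneg _), Real.sqrt_sq_eq_abs]
  rw [map_smul, h1, hs, hs, hs]
  have hn : φ^[n] x ∈ K := hmaps.iterate n hx
  have h2 := hg₁ _ hn
  have h3 := hg₀ _ hx
  have hc₁ : 0 ≤ c₁ := (Real.sqrt_nonneg _).trans h2
  calc |ν| * (|μ| * √(g (φ^[n] x) (e (φ^[n] x)) (e (φ^[n] x)))) ≤ |ν| * (r ^ n * c₁) := by
        gcongr
    _ = c₁ / c₀ * r ^ n * (|ν| * c₀) := by field_simp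
    _ ≤ _ := by gcongr

end Contraction

/-! ### Invariant slopes by monotone iteration -/

section Slopes

/-- A monotone, bounded family of fibre maps over `ψ` has an invariant section. -/
theorem exists_invariant_section {X : Type*} {K : Set X} {ψ : X → X} (hψ : MapsTo ψ K K)
    {F : X → ℝ → ℝ} {B : ℝ} (hmono : ∀ x ∈ K, MonotoneOn (F x) (Ici 0))
    (hcont : ∀ x ∈ K, ContinuousOn (F x) (Ici 0)) (h0 : ∀ x ∈ K, ∀ y, 0 ≤ y → 0 ≤ F x y)
    (hB : ∀ x ∈ K, ∀ y, 0 ≤ y → F x y ≤ B) :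
    ∃ u : X → ℝ, ∀ x ∈ K, 0 ≤ u x ∧ u x = F x (u (ψ x)) := by
  let U : ℕ → X → ℝ := fun n => Nat.rec (fun _ => 0) (fun _ U x => F x (U (ψ x))) n
  have hU : ∀ n x, U (n + 1) x = F x (U n (ψ x)) := fun n x => rfl
  have hU0 : ∀ n, ∀ x ∈ K, 0 ≤ U n x := by
    intro n
    induction n with
    | zero => intro x _; exact le_rfl
    | succ n ih => intro x hx; rw [hU]; exact h0 x hx _ (ih _ (hψ hx))
  have hstep : ∀ n, ∀ x ∈ K, U n x ≤ U (n + 1) x := by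
    intro n
    induction n with
    | zero => intro x hx; exact hU0 1 x hx
    | succ n ih =>
      intro x hx
      rw [hU, hU (n + 1)]
      exact hmono x hx (hU0 n _ (hψ hx)) (hU0 (n + 1) _ (hψ hx)) (ih _ (hψ hx))
  -- The index is shifted because `U (n + 1) x` is a value of `F x`, to which the bound `B` applies
  -- directly; `U 0` is not such a value.
  have hbdd : ∀ x ∈ K, BddAbove (range fun n => U (n + 1) x) := by
    rintro x hx
    refine ⟨B, ?_⟩
    rintro _ ⟨n, rfl⟩
    exact hB x hx _ (hU0 n _ (hψ hx))
  have hlim : ∀ x ∈ K, Tendsto (fun n => U n x) atTop (𝓝 (⨆ n, U (n + 1) x)) := fun x hx =>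
    (tendsto_add_atTop_iff_nat 1).1 <| tendsto_atTop_ciSup
      (monotone_nat_of_le_succ fun n => hstep (n + 1) x hx) (hbdd x hx)
  have hnn : ∀ x ∈ K, 0 ≤ ⨆ n, U (n + 1) x := fun x hx =>
    ge_of_tendsto' (hlim x hx) fun n => hU0 n x hx
  refine ⟨fun x => ⨆ n, U (n + 1) x, fun x hx => ⟨hnn x hx, ?_⟩⟩
  have h1 := ((hcont x hx) _ (hnn _ (hψ hx))).tendsto.comp
    (tendsto_nhdsWithin_iff.2 ⟨hlim _ (hψ hx), Eventually.of_forall fun n => hU0 n _ (hψ hx)⟩)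
  exact tendsto_nhds_unique ((tendsto_add_atTop_iff_nat 1).2 (hlim x hx)) h1

/-- The unstable slope at a point depends on its past, so the fibre maps lie over `ψ`. They are
increasing and bounded because `y / (1 + t y)` increases from `0` and stays below `1 / t`. The last
clause is invariance of the line spanned by `e₁ + u e₂`, cleared of denominators. -/
theorem exists_unstable_slope {X : Type*} {K : Set X} {φ ψ : X → X} (hφ : MapsTo φ K K)
    (hψ : MapsTo ψ K K) (hψφ : ∀ x ∈ K, ψ (φ x) = x) {t a : X → ℝ} {t₀ a₁ : ℝ} (ht₀ : 0 < t₀)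
    (ht : ∀ x ∈ K, t₀ ≤ t x) (ha : ∀ x ∈ K, 0 ≤ a x) (ha₁ : ∀ x ∈ K, a x ≤ a₁) :
    ∃ u : X → ℝ, ∀ x ∈ K, a x ≤ u x ∧ u x ≤ a₁ + 1 / t₀ ∧
      u (φ x) * (1 + t x * u x) = a (φ x) + u x * (1 + t x * a (φ x)) := by
  have key : ∀ x ∈ K, ∀ y : ℝ, 0 ≤ y → 0 < 1 + t x * y := fun x hx y hy => by
    have := ht₀.trans_le (ht x hx); positivity
  have hq : ∀ x ∈ K, ∀ y : ℝ, 0 ≤ y → y / (1 + t x * y) ≤ 1 / t₀ := fun x hx y hy => by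
    rw [div_le_div_iff₀ (key x hx y hy) ht₀]
    nlinarith [ht x hx]
  obtain ⟨u, hu⟩ := exists_invariant_section hψ
    (F := fun x y => a x + y / (1 + t (ψ x) * y)) (B := a₁ + 1 / t₀)
    (fun x hx y hy z hz hyz => by
      have h1 := key _ (hψ hx) y hy
      have h2 := key _ (hψ hx) z hz
      have : y / (1 + t (ψ x) * y) ≤ z / (1 + t (ψ x) * z) := by
        rw [div_le_div_iff₀ h1 h2]; nlinarith
      simpa using this)
    (fun x hx => continuousOn_const.add (continuousOn_id.div (by fun_prop)
      fun y hy => (key _ (hψ hx) y hy).ne'))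
    (fun x hx y hy => add_nonneg (ha x hx) (div_nonneg hy (key _ (hψ hx) y hy).le))
    (fun x hx y hy => add_le_add (ha₁ x hx) (hq _ (hψ hx) y hy))
  refine ⟨u, fun x hx => ⟨?_, ?_, ?_⟩⟩
  · rw [(hu x hx).2]
    have := div_nonneg (hu _ (hψ hx)).1 (key _ (hψ hx) _ (hu _ (hψ hx)).1).le
    linarith
  · rw [(hu x hx).2]
    exact add_le_add (ha₁ x hx) (hq _ (hψ hx) _ (hu _ (hψ hx)).1)
  · have h1 := (hu _ (hφ hx)).2
    have h2 := (key x hx _ (hu x hx).1).ne'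
    rw [hψφ x hx] at h1
    rw [h1, add_mul, div_mul_cancel₀ _ h2]
    ring

/-- The stable line is spanned by `e₁ - s e₂`, and solving its invariance backwards expresses `s x`
through `s (φ x)`, so the iteration runs over the future. The product clause exhibits the multiplier
`1 - t s` as the inverse of a number greater than one when `a` is positive. -/
theorem exists_stable_slope {X : Type*} {K : Set X} {φ : X → X} (hφ : MapsTo φ K K)
    {t a : X → ℝ} {t₀ : ℝ} (ht₀ : 0 < t₀)
    (ht : ∀ x ∈ K, t₀ ≤ t x) (ha : ∀ x ∈ K, 0 ≤ a x) :
    ∃ s : X → ℝ, ∀ x ∈ K, 0 ≤ s x ∧ s x ≤ 1 / t₀ ∧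
      (1 - t x * s x) * (1 + t x * (s (φ x) + a (φ x))) = 1 ∧
      s (φ x) * (1 - t x * s x) = s x * (1 + t x * a (φ x)) - a (φ x) := by
  have key : ∀ x ∈ K, ∀ y : ℝ, 0 ≤ y → 0 < 1 + t x * (y + a (φ x)) := fun x hx y hy => by
    have := ht₀.trans_le (ht x hx)
    have := ha _ (hφ hx)
    positivity
  have hq : ∀ x ∈ K, ∀ y : ℝ, 0 ≤ y → (y + a (φ x)) / (1 + t x * (y + a (φ x))) ≤ 1 / t₀ :=
    fun x hx y hy => by
      rw [div_le_div_iff₀ (key x hx y hy) ht₀]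
      nlinarith [ht x hx, ha _ (hφ hx)]
  obtain ⟨s, hs⟩ := exists_invariant_section hφ
    (F := fun x y => (y + a (φ x)) / (1 + t x * (y + a (φ x)))) (B := 1 / t₀)
    (fun x hx y hy z hz hyz => by
      have h1 := key _ hx y hy
      have h2 := key _ hx z hz
      simp only
      rw [div_le_div_iff₀ h1 h2]; nlinarith)
    (fun x hx => ContinuousOn.div (by fun_prop) (by fun_prop)
      fun y hy => (key _ hx y hy).ne')
    (fun x hx y hy => div_nonneg (add_nonneg hy (ha _ (hφ hx))) (key _ hx y hy).le)
    (fun x hx y hy => hq _ hx y hy)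
  refine ⟨s, fun x hx => ⟨(hs x hx).1, ?_, ?_, ?_⟩⟩
  · rw [(hs x hx).2]
    exact hq _ hx _ (hs _ (hφ hx)).1
  all_goals
    have h1 := (hs _ hx).2
    have h2 := (key x hx _ (hs _ (hφ hx)).1).ne'
    rw [h1]
    field_simp
    ring

end Slopes

/-! ### The hyperbolic splitting -/

section Splitting

variable {V : Type*} [NormedAddCommGroup V] [NormedSpace ℝ V]

/-- A diffeomorphism whose differential acts on a frame `e₁, e₂` of the tangent planes by matrices
`-!![1, t; a, 1 + t * a]`, with `t` and `a` bounded and bounded away from zero, has a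
hyperbolic splitting. -/
theorem exists_splitting_of_dispersing {M K : Set V} {φ ψ : V → V} {e₁ e₂ : V → V} {t a : V → ℝ}
    {t₀ a₀ a₁ c₀ c₁ : ℝ} {g : V → V →L[ℝ] V →L[ℝ] ℝ} (hg : IsRiemannianMetricOn M g)
    (hφ : MapsTo φ K K) (hψ : MapsTo ψ K K) (hKM : K ⊆ M)
    (hψφ : ∀ x ∈ K, ∀ᶠ y in 𝓝[M] x, ψ (φ y) = y) (hφψ : ∀ x ∈ K, φ (ψ x) = x)
    (hφM : ∀ x ∈ K, ∀ᶠ y in 𝓝[M] x, φ y ∈ M) (hψM : ∀ x ∈ K, ∀ᶠ y in 𝓝[M] x, ψ y ∈ M)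
    (hφd : ∀ x ∈ K, DifferentiableWithinAt ℝ φ M x)
    (hψd : ∀ x ∈ K, DifferentiableWithinAt ℝ ψ M x)
    (hT : ∀ x ∈ K, embTangentSpace M x = Submodule.span ℝ {e₁ x, e₂ x})
    (hli : ∀ x ∈ K, LinearIndependent ℝ ![e₁ x, e₂ x])
    (he₁ : ∀ x ∈ K, fderivWithin ℝ φ M x (e₁ x) = -(e₁ (φ x) + a (φ x) • e₂ (φ x)))
    (he₂ : ∀ x ∈ K, fderivWithin ℝ φ M x (e₂ x) =
      -(t x • e₁ (φ x) + (1 + t x * a (φ x)) • e₂ (φ x)))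
    (ht₀ : 0 < t₀) (ht : ∀ x ∈ K, t₀ ≤ t x) (ha₀ : 0 < a₀) (ha : ∀ x ∈ K, a₀ ≤ a x)
    (ha₁ : ∀ x ∈ K, a x ≤ a₁) (hc₀ : 0 < c₀) (hc₁ : 0 < c₁)
    (hg₀ : ∀ x ∈ K, ∀ β : ℝ, c₀ ≤ √(g x (e₁ x + β • e₂ x) (e₁ x + β • e₂ x)))
    (hg₁ : ∀ x ∈ K, ∀ β : ℝ, √(g x (e₁ x + β • e₂ x) (e₁ x + β • e₂ x)) ≤ c₁ * (1 + |β|)) :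
    ∃ Eu Es : V → Submodule ℝ V,
      (∀ x ∈ K, Eu x ⊔ Es x = embTangentSpace M x ∧ Disjoint (Eu x) (Es x) ∧
        Module.finrank ℝ (Eu x) = 1 ∧ Module.finrank ℝ (Es x) = 1) ∧
      (∀ x ∈ K, (Eu x).map (fderivWithin ℝ φ M x : V →ₗ[ℝ] V) = Eu (φ x) ∧
        (Es x).map (fderivWithin ℝ φ M x : V →ₗ[ℝ] V) = Es (φ x)) ∧
      ∃ (g : V → V →L[ℝ] V →L[ℝ] ℝ) (C r : ℝ), IsRiemannianMetricOn M g ∧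
        0 < C ∧ 0 < r ∧ r < 1 ∧
        (∀ x ∈ K, ∀ v ∈ Eu x, ∀ n : ℕ,
          let y := ψ^[n] x
          let w := fderivWithin ℝ (ψ^[n]) M x v
          √(g y w w) ≤ C * r ^ n * √(g x v v)) ∧
        (∀ x ∈ K, ∀ v ∈ Es x, ∀ n : ℕ,
          let y := φ^[n] x
          let w := fderivWithin ℝ (φ^[n]) M x v
          √(g y w w) ≤ C * r ^ n * √(g x v v)) := by
  have ha' : ∀ x ∈ K, 0 ≤ a x := fun x hx => ha₀.le.trans (ha x hx)
  have hψφ' : ∀ x ∈ K, ψ (φ x) = x := fun x hx => (hψφ x hx).self_of_nhdsWithin (hKM hx)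
  obtain ⟨u, hu⟩ := exists_unstable_slope hφ hψ hψφ' ht₀ ht ha' ha₁
  obtain ⟨s, hs⟩ := exists_stable_slope hφ ht₀ ht ha'
  set eu : V → V := fun x => e₁ x + u x • e₂ x with heu
  set es : V → V := fun x => e₁ x + (-s x) • e₂ x with hes
  set r : ℝ := (1 + t₀ * a₀)⁻¹ with hr
  have hta : 0 < t₀ * a₀ := mul_pos ht₀ ha₀
  have hr0 : 0 < r := by positivity
  have hr1 : r < 1 := inv_lt_one_of_one_lt₀ (by linarith)
  have hu0 : ∀ x ∈ K, 0 < u x := fun x hx => ha₀.trans_le ((ha x hx).trans (hu x hx).1)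
  have hmu : ∀ x ∈ K, 1 + t₀ * a₀ ≤ 1 + t x * u x := fun x hx => by
    have h1 := ht x hx
    have h2 := (ha x hx).trans (hu x hx).1
    have h3 := ht₀.le.trans h1
    have : t₀ * a₀ ≤ t x * u x := by gcongr
    linarith
  have hms : ∀ x ∈ K, 1 + t₀ * a₀ ≤ 1 + t x * (s (φ x) + a (φ x)) := fun x hx => by
    have h1 := ht x hx
    have h2 : a₀ ≤ s (φ x) + a (φ x) := by linarith [ha _ (hφ hx), (hs _ (hφ hx)).1]
    have h3 := ht₀.le.trans h1
    have : t₀ * a₀ ≤ t x * (s (φ x) + a (φ x)) := by gcongr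
    linarith
  have hdu : ∀ x ∈ K, fderivWithin ℝ φ M x (eu x) = (-(1 + t x * u x)) • eu (φ x) := by
    intro x hx
    simp only [heu, map_add, map_smul, he₁ x hx, he₂ x hx, smul_add, smul_smul, smul_neg]
    have := (hu x hx).2.2
    rw [show -(1 + t x * u x) * u (φ x) = -(a (φ x) + u x * (1 + t x * a (φ x))) by linarith]
    module
  have hds : ∀ x ∈ K, fderivWithin ℝ φ M x (es x) = (-(1 - t x * s x)) • es (φ x) := by
    intro x hx
    simp only [hes, map_add, map_smul, he₁ x hx, he₂ x hx, smul_add, smul_smul, smul_neg]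
    have := (hs x hx).2.2.2
    rw [show -(1 - t x * s x) * -s (φ x) = s x * (1 + t x * a (φ x)) - a (φ x) by linarith]
    module
  have hms' : ∀ x ∈ K, -(1 - t x * s x) = -(1 + t x * (s (φ x) + a (φ x)))⁻¹ := fun x hx => by
    rw [eq_inv_of_mul_eq_one_left (hs x hx).2.2.1]
  have heuT : ∀ x ∈ K, eu x ∈ embTangentSpace M x := fun x hx => by
    rw [hT x hx]
    exact Submodule.mem_span_pair.2 ⟨1, u x, by simp [heu]⟩
  have hesT : ∀ x ∈ K, es x ∈ embTangentSpace M x := fun x hx => by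
    rw [hT x hx]
    exact Submodule.mem_span_pair.2 ⟨1, -s x, by simp [hes]⟩
  -- Differentiate `ψ ∘ φ = id` at `ψ x` and apply it to the tangent vector `eu (ψ x)`; the
  -- multiplier of `ψ` is the inverse of that of `φ`.
  have hdψ : ∀ x ∈ K, fderivWithin ℝ ψ M x (eu x) = (-(1 + t (ψ x) * u (ψ x)))⁻¹ • eu (ψ x) := by
    intro x hx
    have hy := hψ hx
    have h0 : -(1 + t (ψ x) * u (ψ x)) ≠ 0 := by linarith [hmu _ hy]
    have hcomp : HasFDerivWithinAt (ψ ∘ φ)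
        ((fderivWithin ℝ ψ M (φ (ψ x))).comp (fderivWithin ℝ φ M (ψ x))) M (ψ x) := by
      refine HasFDerivWithinAt.comp_of_tendsto (t := M) _ ?_ (hφd _ hy).hasFDerivWithinAt
        (tendsto_nhdsWithin_iff.2 ⟨(hφd _ hy).continuousWithinAt, hφM _ hy⟩)
      exact (hψd _ (hφ hy)).hasFDerivWithinAt
    have hid := (hasFDerivWithinAt_id (𝕜 := ℝ) (ψ x) M).congr_of_eventuallyEq
      (f₁ := ψ ∘ φ) (hψφ _ hy) (hψφ' _ hy)
    have h1 := hcomp.eqOn_embTangentSpace hid (heuT _ hy)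
    simp only [ContinuousLinearMap.comp_apply, hdu _ hy, map_smul, hφψ x hx,
      ContinuousLinearMap.id_apply] at h1
    rw [← h1, smul_smul, inv_mul_cancel₀ h0, one_smul]
  -- A common bound for both slopes. The absolute value keeps it positive when `K` is empty and `a₁`
  -- has no definite sign.
  set cb : ℝ := |a₁| + 1 / t₀
  have hcb : 0 < cb := by positivity
  have hub : ∀ x ∈ K, |u x| ≤ cb := fun x hx => by
    rw [abs_of_pos (hu0 x hx)]
    exact (hu x hx).2.1.trans (by simp only [cb]; gcongr; exact le_abs_self _)
  have hsb : ∀ x ∈ K, |-s x| ≤ cb := fun x hx => by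
    rw [abs_neg, abs_of_nonneg (hs x hx).1]
    exact (hs x hx).2.1.trans (le_add_of_nonneg_left (abs_nonneg _))
  have hmap : ∀ (A : V →L[ℝ] V) (v w : V) (c : ℝ), c ≠ 0 → A v = c • w →
      (Submodule.span ℝ {v}).map (A : V →ₗ[ℝ] V) = Submodule.span ℝ {w} := by
    intro A v w c hc h
    rw [Submodule.map_span, image_singleton, ContinuousLinearMap.coe_coe, h]
    exact Submodule.span_singleton_smul_eq (IsUnit.mk0 c hc) w
  have hne : ∀ x ∈ K, ∀ α β : ℝ, α • e₁ x + β • e₂ x = 0 → α = 0 ∧ β = 0 := fun x hx α β h =>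
    LinearIndependent.pair_iff.1 (hli x hx) α β h
  refine ⟨fun x => Submodule.span ℝ {eu x}, fun x => Submodule.span ℝ {es x},
    fun x hx => ⟨?_, ?_, ?_, ?_⟩, fun x hx => ⟨?_, ?_⟩, g, c₁ * (1 + cb) / c₀ + 1, r, hg, ?_, hr0, hr1,
    ?_, ?_⟩
  · apply le_antisymm
    · rw [sup_le_iff, Submodule.span_singleton_le_iff_mem, Submodule.span_singleton_le_iff_mem]
      exact ⟨heuT x hx, hesT x hx⟩
    -- Transversality: the slopes `u > 0` and `-s ≤ 0` differ, so `e₁` and `e₂` can be solved for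
    -- with denominator `u + s`.
    · have hus : u x + s x ≠ 0 := by linarith [hu0 x hx, (hs x hx).1]
      rw [hT x hx, Submodule.span_le, ← Submodule.span_union, singleton_union]
      rintro _ (rfl | rfl)
      · refine Submodule.mem_span_pair.2 ⟨s x / (u x + s x), u x / (u x + s x), ?_⟩
        have h1 : s x / (u x + s x) + u x / (u x + s x) = 1 := by field_simp; ring
        calc _ = (s x / (u x + s x) + u x / (u x + s x)) • e₁ x := by simp only [heu, hes]; module
          _ = e₁ x := by rw [h1, one_smul]
      · refine Submodule.mem_span_pair.2 ⟨1 / (u x + s x), -1 / (u x + s x), ?_⟩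
        have h1 : 1 / (u x + s x) * u x + -1 / (u x + s x) * -s x = 1 := by field_simp
        calc _ = (1 / (u x + s x) * u x + -1 / (u x + s x) * -s x) • e₂ x := by
              simp only [heu, hes]; module
          _ = e₂ x := by rw [h1, one_smul]
  · rw [Submodule.disjoint_def]
    intro v hv hv'
    obtain ⟨α, rfl⟩ := Submodule.mem_span_singleton.1 hv
    obtain ⟨β, h⟩ := Submodule.mem_span_singleton.1 hv'
    have h1 := hne x hx (β - α) (-(β * s x) - α * u x) (by
      rw [← sub_eq_zero] at h
      rw [← h]
      simp only [heu, hes]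
      module)
    have h2 : α * (u x + s x) = 0 := by
      have : β = α := by linarith [h1.1]
      subst this
      linarith [h1.2]
    have h3 : α = 0 := by
      rcases mul_eq_zero.1 h2 with h | h
      · exact h
      · linarith [hu0 x hx, (hs x hx).1]
    simp [h3]
  · refine finrank_span_singleton fun h => ?_
    exact one_ne_zero (hne x hx 1 (u x) (by simpa [heu] using h)).1
  · refine finrank_span_singleton fun h => ?_
    exact one_ne_zero (hne x hx 1 (-s x) (by simpa [hes] using h)).1
  · exact hmap _ _ _ _ (by linarith [hmu _ hx]) (hdu x hx)
  · refine hmap _ _ _ _ ?_ (hds x hx)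
    rw [hms' x hx]
    exact neg_ne_zero.2 (inv_ne_zero (by linarith [hms x hx]))
  · positivity
  · intro x hx v hv n
    refine (contraction_of_invariant_field (g := g) (c₀ := c₀) (c₁ := c₁ * (1 + cb)) hr0.le hψ hψM
      hψd hdψ (fun x hx => ?_) heuT hc₀ (fun x hx => hg₀ x hx _)
      (fun x hx => (hg₁ x hx _).trans (by gcongr; exact hub x hx)) hx hv n).trans
      (by gcongr; linarith)
    have h1 := hmu _ (hψ hx)
    rw [abs_inv, abs_neg, abs_of_pos (by linarith)]
    exact inv_anti₀ (by linarith) h1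
  · intro x hx v hv n
    refine (contraction_of_invariant_field (g := g) (c₀ := c₀) (c₁ := c₁ * (1 + cb)) hr0.le hφ hφM
      hφd hds (fun x hx => ?_) hesT hc₀ (fun x hx => hg₀ x hx _)
      (fun x hx => (hg₁ x hx _).trans (by gcongr; exact hsb x hx)) hx hv n).trans
      (by gcongr; linarith)
    have h1 := hms _ hx
    rw [hms' x hx, abs_neg, abs_inv, abs_of_pos (by linarith)]
    exact inv_anti₀ (by linarith) h1

end Splitting

namespace Billiard

/-! ### Coordinates and rotation in the plane -/

section PlaneGeometry

theorem inner_eq_coords (x y : Plane) : inner ℝ x y = x 0 * y 0 + x 1 * y 1 := by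
  simp [PiLp.inner_apply, mul_comm]

theorem norm_sq_eq_coords (x : Plane) : ‖x‖ ^ 2 = x 0 ^ 2 + x 1 ^ 2 := by
  rw [← real_inner_self_eq_norm_sq, inner_eq_coords]; ring

theorem coords_of_norm_eq_one {x : Plane} (h : ‖x‖ = 1) : x 0 ^ 2 + x 1 ^ 2 = 1 := by
  rw [← norm_sq_eq_coords, h, one_pow]

theorem norm_eq_one_of_coords {x : Plane} (h : x 0 ^ 2 + x 1 ^ 2 = 1) : ‖x‖ = 1 := by
  rw [← norm_sq_eq_coords] at h
  exact (pow_eq_one_iff_of_nonneg (norm_nonneg x) two_ne_zero).1 h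

/-- Rotation of the plane by a right angle. -/
noncomputable def rot (v : Plane) : Plane := !₂[-v 1, v 0]

@[simp] theorem rot_zero_coord (v : Plane) : rot v 0 = -v 1 := rfl

@[simp] theorem rot_one_coord (v : Plane) : rot v 1 = v 0 := rfl

theorem continuous_rot : Continuous rot := by
  unfold rot
  refine (PiLp.continuous_toLp 2 _).comp (continuous_pi fun i => ?_)
  fin_cases i <;> simp <;> fun_prop

theorem Plane.ext {x y : Plane} (h0 : x 0 = y 0) (h1 : x 1 = y 1) : x = y := by
  ext i; fin_cases i <;> assumption

theorem norm_rot (v : Plane) : ‖rot v‖ = ‖v‖ := by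
  rw [← sq_eq_sq₀ (norm_nonneg _) (norm_nonneg _), norm_sq_eq_coords, norm_sq_eq_coords]
  simp only [rot_zero_coord, rot_one_coord]; ring

/-- A vector orthogonal to the unit vector `n` is a multiple of `rot n`. -/
theorem eq_smul_rot_of_inner_eq_zero {n v : Plane} (hn : ‖n‖ = 1) (h : inner ℝ v n = 0) :
    v = (inner ℝ v (rot n)) • rot n := by
  have h1 := coords_of_norm_eq_one hn
  rw [inner_eq_coords] at h
  rw [inner_eq_coords]
  apply Plane.ext <;> simp only [PiLp.smul_apply, rot_zero_coord, rot_one_coord, smul_eq_mul]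
  · linear_combination (-v 0) * h1 + n 0 * h
  · linear_combination (-v 1) * h1 + n 1 * h

end PlaneGeometry

/-! ### Normal, curvature and transversal hits of the boundary -/

section LocalStructure

variable {Ω : Set Plane} {p : Plane} {f : Plane → ℝ}

/-- The normalized gradient. -/
noncomputable def normalField (f : Plane → ℝ) (y : Plane) : Plane :=
  ‖gradient f y‖⁻¹ • gradient f y

theorem fderiv_eq_inner_normalField (f : Plane → ℝ) (y v : Plane) :
    fderiv ℝ f y v = ‖gradient f y‖ * inner ℝ (normalField f y) v := by
  have h1 : fderiv ℝ f y v = inner ℝ (gradient f y) v := by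
    rw [gradient, InnerProductSpace.toDual_symm_apply]
  rw [h1, normalField, real_inner_smul_left]
  rcases eq_or_ne (gradient f y) 0 with h | h
  · simp [h]
  · rw [mul_inv_cancel_left₀ (norm_ne_zero_iff.2 h)]

namespace IsLocalDefiningFunction

theorem contDiff_gradient (hf : IsLocalDefiningFunction Ω p f) : ContDiff ℝ ∞ (gradient f) := by
  unfold gradient
  exact (InnerProductSpace.toDual ℝ Plane).symm.contDiff.comp (hf.smooth.fderiv_right le_rfl)

theorem norm_normalField (hf : IsLocalDefiningFunction Ω p f) : ‖normalField f p‖ = 1 :=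
  norm_smul_inv_norm hf.gradient_ne_zero

theorem contDiffAt_normalField (hf : IsLocalDefiningFunction Ω p f) :
    ContDiffAt ℝ ∞ (normalField f) p := by
  have h := hf.contDiff_gradient.contDiffAt (x := p)
  exact ((h.norm ℝ hf.gradient_ne_zero).inv (norm_ne_zero_iff.2 hf.gradient_ne_zero)).smul h

theorem eventually (hf : IsLocalDefiningFunction Ω p f) :
    ∀ᶠ y in 𝓝 p, IsLocalDefiningFunction Ω y f := by
  filter_upwards [hf.contDiff_gradient.continuous.continuousAt.eventually_ne hf.gradient_ne_zero,
    hf.mem_iff.eventually_nhds] with y h1 h2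
  exact ⟨hf.smooth, h1, h2⟩

/-- Where `f p ≠ 0`, the point is interior to `Ω` or to its complement. A zero of `f` in the
interior of `Ω` would be a local minimum, against the nonvanishing gradient. -/
theorem mem_frontier_iff (hf : IsLocalDefiningFunction Ω p f) : p ∈ frontier Ω ↔ f p = 0 := by
  have hc : ContinuousAt f p := hf.smooth.continuous.continuousAt
  constructor
  · intro hp
    rcases lt_trichotomy (f p) 0 with h | h | h
    · exfalso
      have : Ωᶜ ∈ 𝓝 p := by
        filter_upwards [hf.mem_iff, hc.eventually_lt_const h] with y h1 h2
        exact fun hy => absurd (h1.1 hy) (not_le.2 h2)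
      exact disjoint_left.1 disjoint_interior_frontier (mem_interior_iff_mem_nhds.2 this)
        (by rwa [frontier_compl])
    · exact h
    · exfalso
      have : Ω ∈ 𝓝 p := by
        filter_upwards [hf.mem_iff, hc.eventually_const_lt h] with y h1 h2
        exact h1.2 h2.le
      exact disjoint_left.1 disjoint_interior_frontier (mem_interior_iff_mem_nhds.2 this) hp
  · intro h
    refine ⟨subset_closure (hf.mem_iff.self_of_nhds.2 h.ge), fun hi => hf.gradient_ne_zero ?_⟩
    have hmin : IsLocalMin f p := by
      filter_upwards [hf.mem_iff, mem_interior_iff_mem_nhds.1 hi] with y h1 h2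
      exact h.trans_le (h1.1 h2)
    rw [gradient, hmin.fderiv_eq_zero, map_zero]

theorem eventually_mem_frontier_iff (hf : IsLocalDefiningFunction Ω p f) :
    ∀ᶠ y in 𝓝 p, (y ∈ frontier Ω ↔ f y = 0) :=
  hf.eventually.mono fun _ h => h.mem_frontier_iff

theorem tendsto_slope (hf : IsLocalDefiningFunction Ω p f) (hp : p ∈ frontier Ω) (v : Plane) :
    Tendsto (fun s : ℝ => s⁻¹ * f (p + s • v)) (𝓝[>] 0) (𝓝 (fderiv ℝ f p v)) := by
  have h1 : HasDerivAt (fun s : ℝ => f (p + s • v)) (fderiv ℝ f p v) 0 := by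
    have h2 : HasDerivAt (fun s : ℝ => p + s • v) v 0 := by
      simpa using ((hasDerivAt_id (0 : ℝ)).smul_const v).const_add p
    have h3 : HasFDerivAt f (fderiv ℝ f p) (p + (0 : ℝ) • v) := by
      simpa using (hf.smooth.differentiable (by simp) p).hasFDerivAt
    exact h3.comp_hasDerivAt 0 h2
  simpa [hf.mem_frontier_iff.1 hp] using h1.tendsto_slope_zero_right

/-- If the normals `a` and `b` differed, a short step in the direction `a - b` would increase `f`
and decrease `f'`, hence lie both inside and outside `Ω`. -/
theorem normalField_eq {f' : Plane → ℝ} (hf : IsLocalDefiningFunction Ω p f)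
    (hf' : IsLocalDefiningFunction Ω p f') (hp : p ∈ frontier Ω) :
    normalField f p = normalField f' p := by
  by_contra hne
  set a := normalField f p with ha
  set b := normalField f' p with hb
  have h1 : ‖a‖ = 1 := hf.norm_normalField
  have h2 : ‖b‖ = 1 := hf'.norm_normalField
  have hab : inner ℝ a b < 1 := by
    rw [inner_lt_one_iff_real_of_norm_eq_one h1 h2]
    exact hne
  have h3 : 0 < fderiv ℝ f p (a - b) := by
    rw [fderiv_eq_inner_normalField, inner_sub_right, ← ha, real_inner_self_eq_norm_sq, h1]
    exact mul_pos (norm_pos_iff.2 hf.gradient_ne_zero) (by linarith)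
  have h4 : fderiv ℝ f' p (a - b) < 0 := by
    rw [fderiv_eq_inner_normalField, inner_sub_right, ← hb, real_inner_self_eq_norm_sq, h2,
      real_inner_comm]
    exact mul_neg_of_pos_of_neg (norm_pos_iff.2 hf'.gradient_ne_zero) (by linarith)
  have htend : Tendsto (fun s : ℝ => p + s • (a - b)) (𝓝[>] 0) (𝓝 p) := by
    have : ContinuousAt (fun s : ℝ => p + s • (a - b)) 0 := by fun_prop
    simpa [ContinuousAt] using this.tendsto.mono_left nhdsWithin_le_nhds
  obtain ⟨s, hs1, hs2, hs3, hs4, hs5⟩ :=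
    (((hf.tendsto_slope hp _).eventually_const_lt h3).and
    (((hf'.tendsto_slope hp _).eventually_lt_const h4).and ((htend.eventually hf.mem_iff).and
    ((htend.eventually hf'.mem_iff).and self_mem_nhdsWithin)))).exists
  have hs5 : 0 < s := hs5
  have h5 : 0 < f (p + s • (a - b)) := pos_of_mul_pos_right hs1 (inv_nonneg.2 hs5.le)
  have h6 := hs4.1 (hs3.2 h5.le)
  have : 0 ≤ s⁻¹ * f' (p + s • (a - b)) := by positivity
  linarith

theorem inwardNormal_eq (hf : IsLocalDefiningFunction Ω p f) (hp : p ∈ frontier Ω) :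
    inwardNormal Ω p = normalField f p := by
  have h : ∃ ν, IsInwardUnitNormal Ω p ν := ⟨_, f, hf, rfl⟩
  obtain ⟨f', hf', h'⟩ := h.choose_spec
  rw [inwardNormal, dif_pos h, h']
  exact hf'.normalField_eq hf hp

theorem eventually_inwardNormal_eq (hf : IsLocalDefiningFunction Ω p f) :
    ∀ᶠ y in 𝓝 p, y ∈ frontier Ω → inwardNormal Ω y = normalField f y :=
  hf.eventually.mono fun _ h hy => h.inwardNormal_eq hy

theorem inner_fderiv_normalField (hf : IsLocalDefiningFunction Ω p f) (v : Plane) :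
    inner ℝ (fderiv ℝ (normalField f) p v) (normalField f p) = 0 := by
  have hd : HasFDerivAt (normalField f) (fderiv ℝ (normalField f) p) p :=
    (hf.contDiffAt_normalField.differentiableAt (by simp)).hasFDerivAt
  have h1 := hd.inner ℝ hd
  have h2 : (fun y => inner ℝ (normalField f y) (normalField f y)) =ᶠ[𝓝 p] fun _ => (1 : ℝ) :=
    hf.eventually.mono fun y hy => by
      simp only [real_inner_self_eq_norm_sq, hy.norm_normalField, one_pow]
  have h3 := congrArg (fun L => L v) (h1.unique ((hasFDerivAt_const (1 : ℝ) p).congr_of_eventuallyEq h2))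
  simp only [ContinuousLinearMap.comp_apply, ContinuousLinearMap.prod_apply,
    fderivInnerCLM_apply, zero_apply] at h3
  rw [real_inner_comm] at h3
  linarith

/-- A unit speed parametrization of the boundary has tangent velocity, and its acceleration
determines the derivative of the normal. -/
theorem exists_curve (hf : IsLocalDefiningFunction Ω p f) {k : ℝ} (hp : p ∈ frontier Ω)
    (hk : IsBoundaryCurvature Ω p k) :
    ∃ (γ : ℝ → Plane) (τ : Plane), γ 0 = p ∧ HasDerivAt γ τ 0 ∧ (∀ᶠ s in 𝓝 (0 : ℝ), γ s ∈ frontier Ω) ∧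
      ‖τ‖ = 1 ∧ inner ℝ τ (normalField f p) = 0 ∧
      inner ℝ (fderiv ℝ (normalField f) p τ) τ = -k := by
  obtain ⟨γ, hγ, h0, hev, hacc⟩ := hk
  have hγd : ∀ s, HasDerivAt γ (deriv γ s) s := fun s =>
    (hγ.differentiable (by simp) s).hasDerivAt
  have hγ2 : HasDerivAt (deriv γ) (deriv (deriv γ) 0) 0 := by
    have : ContDiff ℝ ∞ (deriv γ) := by
      have := hγ.iterate_deriv 1
      simpa using this
    exact (this.differentiable (by simp) 0).hasDerivAt
  have hγt : Tendsto γ (𝓝 0) (𝓝 p) := by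
    have := hγ.continuous.tendsto 0
    rwa [h0] at this
  have horth : ∀ᶠ s in 𝓝 (0 : ℝ), inner ℝ (normalField f (γ s)) (deriv γ s) = 0 := by
    have hz : ∀ᶠ s in 𝓝 (0 : ℝ), f (γ s) = 0 := by
      filter_upwards [hev, hγt.eventually hf.eventually_mem_frontier_iff] with s h1 h2
      exact h2.1 h1.1
    filter_upwards [hz.eventually_nhds, hγt.eventually hf.eventually] with s h1 h2
    have h3 : HasDerivAt (fun s => f (γ s)) (fderiv ℝ f (γ s) (deriv γ s)) s :=
      (hf.smooth.differentiable (by simp) (γ s)).hasFDerivAt.comp_hasDerivAt s (hγd s)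
    have h4 := h3.unique ((hasDerivAt_const s (0 : ℝ)).congr_of_eventuallyEq h1)
    rw [fderiv_eq_inner_normalField] at h4
    exact (mul_eq_zero.1 h4).resolve_left (norm_ne_zero_iff.2 h2.gradient_ne_zero)
  have hN : HasDerivAt (fun s => normalField f (γ s))
      (fderiv ℝ (normalField f) p (deriv γ 0)) 0 := by
    have : HasFDerivAt (normalField f) (fderiv ℝ (normalField f) p) (γ 0) := by
      rw [h0]; exact (hf.contDiffAt_normalField.differentiableAt (by simp)).hasFDerivAt
    exact this.comp_hasDerivAt 0 (hγd 0)
  -- Differentiating `⟨N(γ), γ'⟩ = 0` gives `⟨N', γ'⟩ + ⟨N, γ''⟩ = 0`, and `γ''(0) = k n`.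
  have h5 := (hN.inner ℝ hγ2).unique ((hasDerivAt_const (0 : ℝ) (0 : ℝ)).congr_of_eventuallyEq horth)
  refine ⟨γ, deriv γ 0, h0, hγd 0, hev.mono fun s h => h.1, hev.self_of_nhds.2, ?_, ?_⟩
  · have := horth.self_of_nhds
    rwa [h0, real_inner_comm] at this
  · rw [hacc, h0, hf.inwardNormal_eq hp, real_inner_smul_right, real_inner_self_eq_norm_sq,
      hf.norm_normalField] at h5
    linarith

/-- The unit tangent of the curve is `± rot n`, and a quadratic form does not see the sign. -/
theorem inner_fderiv_normalField_rot (hf : IsLocalDefiningFunction Ω p f) {k : ℝ}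
    (hp : p ∈ frontier Ω) (hk : IsBoundaryCurvature Ω p k) :
    inner ℝ (fderiv ℝ (normalField f) p (rot (normalField f p))) (rot (normalField f p)) = -k := by
  obtain ⟨γ, τ, -, -, -, hτ, hτn, h⟩ := hf.exists_curve hp hk
  have h1 := eq_smul_rot_of_inner_eq_zero hf.norm_normalField hτn
  set c := inner ℝ τ (rot (normalField f p))
  have hc : c * c = 1 := by
    have := congrArg (fun v => ‖v‖ ^ 2) h1
    simp only [norm_smul, norm_rot, hf.norm_normalField, hτ, Real.norm_eq_abs, mul_one, sq_abs] at this
    nlinarith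
  rw [h1, map_smul, real_inner_smul_left, real_inner_smul_right, ← mul_assoc, hc, one_mul] at h
  exact h

/-- The derivative of the normal along the boundary. -/
theorem fderiv_normalField_of_tangent (hf : IsLocalDefiningFunction Ω p f) {k : ℝ}
    (hp : p ∈ frontier Ω) (hk : IsBoundaryCurvature Ω p k) {v : Plane}
    (hv : inner ℝ v (normalField f p) = 0) : fderiv ℝ (normalField f) p v = (-k) • v := by
  have hn := hf.norm_normalField
  have h1 := eq_smul_rot_of_inner_eq_zero hn (hf.inner_fderiv_normalField (rot (normalField f p)))
  rw [hf.inner_fderiv_normalField_rot hp hk] at h1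
  rw [eq_smul_rot_of_inner_eq_zero hn hv, map_smul, h1, smul_comm]

end IsLocalDefiningFunction

theorem HasSmoothBoundary.norm_inwardNormal (hΩ : HasSmoothBoundary Ω) (hp : p ∈ frontier Ω) :
    ‖inwardNormal Ω p‖ = 1 := by
  obtain ⟨f, hf⟩ := hΩ p hp
  rw [hf.inwardNormal_eq hp, hf.norm_normalField]

theorem HasSmoothBoundary.continuousOn_inwardNormal (hΩ : HasSmoothBoundary Ω) :
    ContinuousOn (inwardNormal Ω) (frontier Ω) := by
  intro p hp
  obtain ⟨f, hf⟩ := hΩ p hp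
  refine hf.contDiffAt_normalField.continuousAt.continuousWithinAt.congr_of_eventuallyEq ?_
    (hf.inwardNormal_eq hp)
  exact eventually_nhdsWithin_iff.2 hf.eventually_inwardNormal_eq

/-- The default value of the curvature is `0`, so a negative value is genuine. -/
theorem isBoundaryCurvature_of_neg (h : boundaryCurvature Ω p < 0) :
    IsBoundaryCurvature Ω p (boundaryCurvature Ω p) := by
  by_cases hk : ∃ k, IsBoundaryCurvature Ω p k
  · rw [boundaryCurvature, dif_pos hk]
    exact hk.choose_spec
  · rw [boundaryCurvature, dif_neg hk] at h
    exact absurd h (lt_irrefl _)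

/-- Where the curvature is negative it equals `-⟨dN (rot n), rot n⟩`, which is continuous in the
base point. -/
theorem HasSmoothBoundary.continuousOn_boundaryCurvature (hΩ : HasSmoothBoundary Ω) :
    ContinuousOn (boundaryCurvature Ω) {p | p ∈ frontier Ω ∧ boundaryCurvature Ω p < 0} := by
  rintro p ⟨hp, hk⟩
  obtain ⟨f, hf⟩ := hΩ p hp
  have key : ∀ {y}, IsLocalDefiningFunction Ω y f → y ∈ frontier Ω → boundaryCurvature Ω y < 0 →
      boundaryCurvature Ω y = -inner ℝ (fderiv ℝ (normalField f) y (rot (normalField f y)))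
        (rot (normalField f y)) := fun h1 h2 h3 => by
    rw [h1.inner_fderiv_normalField_rot h2 (isBoundaryCurvature_of_neg h3), neg_neg]
  have hN := hf.contDiffAt_normalField
  have hr : ContinuousAt (fun y => rot (normalField f y)) p :=
    continuous_rot.continuousAt.comp hN.continuousAt
  have hD : ContinuousAt (fderiv ℝ (normalField f)) p :=
    (hN.fderiv_right (m := ∞) le_rfl).continuousAt
  refine ((hD.clm_apply hr).inner hr).neg.continuousWithinAt.congr_of_eventuallyEq ?_
    (key hf hp hk)
  filter_upwards [mem_nhdsWithin_of_mem_nhds hf.eventually, self_mem_nhdsWithin] with y h1 h2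
  exact key h1 h2.1 h2.2

/-- Near a transversal intersection of a line with the boundary, the intersection is unique and
its parameter depends smoothly on the line. -/
theorem HasSmoothBoundary.exists_smooth_hitting_time (hΩ : HasSmoothBoundary Ω)
    {ρ : Plane × Plane} {s₀ : ℝ} (hp : ρ.1 + s₀ • ρ.2 ∈ frontier Ω)
    (hv : inner ℝ ρ.2 (inwardNormal Ω (ρ.1 + s₀ • ρ.2)) ≠ 0) :
    ∃ T : Plane × Plane → ℝ, ContDiffAt ℝ ∞ T ρ ∧ T ρ = s₀ ∧
      ∀ᶠ z in 𝓝 (ρ, s₀), (z.1.1 + z.2 • z.1.2 ∈ frontier Ω ↔ T z.1 = z.2) := by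
  obtain ⟨f, hf⟩ := hΩ _ hp
  let G : (Plane × Plane) × ℝ → Plane := fun z => z.1.1 + z.2 • z.1.2
  have hG : ContDiff ℝ ∞ G := by fun_prop
  have hFG : ContDiff ℝ ∞ (f ∘ G) := hf.smooth.comp hG
  have hder : fderiv ℝ (f ∘ G) (ρ, s₀) (0, 1) = fderiv ℝ f (ρ.1 + s₀ • ρ.2) ρ.2 := by
    have h1 : HasDerivAt (fun s : ℝ => ((ρ, s₀ + s) : (Plane × Plane) × ℝ)) (0, 1) 0 :=
      (hasDerivAt_const (0 : ℝ) ρ).prodMk ((hasDerivAt_id (0 : ℝ)).const_add s₀)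
    have h2 : HasDerivAt (fun s : ℝ => ρ.1 + (s₀ + s) • ρ.2) ρ.2 0 := by
      simpa using (((hasDerivAt_id (0 : ℝ)).const_add s₀).smul_const ρ.2).const_add ρ.1
    have h3 : HasFDerivAt (f ∘ G) (fderiv ℝ (f ∘ G) (ρ, s₀)) (ρ, s₀ + 0) := by
      rw [add_zero]; exact (hFG.differentiable (by simp) _).hasFDerivAt
    have h4 : HasFDerivAt f (fderiv ℝ f (ρ.1 + s₀ • ρ.2)) (ρ.1 + (s₀ + 0) • ρ.2) := by
      rw [add_zero]; exact (hf.smooth.differentiable (by simp) _).hasFDerivAt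
    exact (h3.comp_hasDerivAt 0 h1).unique (h4.comp_hasDerivAt 0 h2)
  -- Transversality is exactly the nonvanishing of the derivative of `f (x + s w)` in `s`, as the
  -- implicit function theorem requires.
  have hne : fderiv ℝ (f ∘ G) (ρ, s₀) (0, 1) ≠ 0 := by
    rw [hder, fderiv_eq_inner_normalField]
    refine mul_ne_zero (norm_ne_zero_iff.2 hf.gradient_ne_zero) ?_
    rwa [← hf.inwardNormal_eq hp, real_inner_comm]
  have hinv : (fderiv ℝ (f ∘ G) (ρ, s₀) ∘L .inr ℝ (Plane × Plane) ℝ).IsInvertible := by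
    refine ⟨ContinuousLinearEquiv.unitsEquivAut ℝ (Units.mk0 _ hne), ?_⟩
    ext
    simp
  have cdf : ContDiffAt ℝ ∞ (f ∘ G) (ρ, s₀) := hFG.contDiffAt
  refine ⟨cdf.implicitFunction (by simp) hinv, cdf.contDiffAt_implicitFunction (by simp) hinv,
    cdf.implicitFunction_apply_self (by simp) hinv, ?_⟩
  have h0 : (f ∘ G) (ρ, s₀) = 0 := hf.mem_frontier_iff.1 hp
  filter_upwards [cdf.eventually_apply_eq_iff_implicitFunction (by simp) hinv,
    (hG.continuous.tendsto (ρ, s₀)).eventually hf.eventually_mem_frontier_iff] with z h1 h2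
  rw [h0] at h1
  exact h2.trans h1

end LocalStructure

end Billiard

namespace Billiard

/-! ### Bounces and time reversal -/

section Bounce

variable {Ω : Set Plane} {p q : Plane × Plane}

theorem norm_reflect {n w : Plane} (hn : ‖n‖ = 1) (hw : ‖w‖ = 1) :
    ‖w - (2 * inner ℝ w n) • n‖ = 1 := by
  have h1 := coords_of_norm_eq_one hn
  have h2 := coords_of_norm_eq_one hw
  apply norm_eq_one_of_coords
  simp only [inner_eq_coords, PiLp.sub_apply, PiLp.smul_apply, smul_eq_mul]
  linear_combination h2 + (4 * (w 0 * n 0 + w 1 * n 1) ^ 2) * h1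

theorem inner_reflect {n : Plane} (hn : ‖n‖ = 1) (w : Plane) :
    inner ℝ (w - (2 * inner ℝ w n) • n) n = -inner ℝ w n := by
  rw [inner_sub_left, real_inner_smul_left, real_inner_self_eq_norm_sq, hn]
  ring

theorem reflect_reflect {n : Plane} (hn : ‖n‖ = 1) (w : Plane) :
    (w - (2 * inner ℝ w n) • n) - (2 * inner ℝ (w - (2 * inner ℝ w n) • n) n) • n = w := by
  rw [inner_reflect hn]
  module

/-- Reversal of the direction of motion, as a map of outgoing directions. -/
noncomputable def timeReversal (Ω : Set Plane) (p : Plane × Plane) : Plane × Plane :=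
  (p.1, -(p.2 - (2 * inner ℝ p.2 (inwardNormal Ω p.1)) • inwardNormal Ω p.1))

theorem timeReversal_mem (hΩ : HasSmoothBoundary Ω) (hp : p ∈ phaseInterior Ω) :
    timeReversal Ω p ∈ phaseInterior Ω := by
  obtain ⟨h1, h2, h3⟩ := hp
  have hn := hΩ.norm_inwardNormal h1
  refine ⟨h1, ?_, ?_⟩
  · rw [timeReversal, norm_neg, norm_reflect hn h2]
  · simp only [timeReversal]
    rw [inner_neg_left, inner_reflect hn, neg_neg]
    exact h3

theorem timeReversal_timeReversal (hΩ : HasSmoothBoundary Ω) (hp : p.1 ∈ frontier Ω) :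
    timeReversal Ω (timeReversal Ω p) = p := by
  have hn := hΩ.norm_inwardNormal hp
  refine Prod.ext rfl ?_
  have h := reflect_reflect hn p.2
  set w := p.2 - (2 * inner ℝ p.2 (inwardNormal Ω p.1)) • inwardNormal Ω p.1 with hw
  simp only [timeReversal, ← hw]
  rw [inner_neg_left, mul_neg, neg_smul, ← neg_sub', neg_neg, h]

theorem IsBounce.unique {q' : Plane × Plane} (h : IsBounce Ω p q) (h' : IsBounce Ω p q') :
    q = q' := by
  obtain ⟨-, hq, ⟨t, ht, hqt, hfree⟩, hw⟩ := h
  obtain ⟨-, hq', ⟨t', ht', hqt', hfree'⟩, hw'⟩ := h'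
  have htt : t = t' := by
    rcases lt_trichotomy t t' with h | h | h
    · exact absurd (hqt ▸ hq.1) (hfree' t ⟨ht, h⟩)
    · exact h
    · exact absurd (hqt' ▸ hq'.1) (hfree t' ⟨ht', h⟩)
  have h1 : q.1 = q'.1 := by rw [hqt, hqt', htt]
  refine Prod.ext h1 ?_
  rw [hw, hw', h1]

theorem IsBounce.mem_domain (h : IsBounce Ω p q) : p ∈ billiardDomain Ω := ⟨q, h⟩

theorem isBounce_billiardMap (h : p ∈ billiardDomain Ω) : IsBounce Ω p (billiardMap Ω p) := by
  rw [billiardMap, dif_pos (show ∃ q, IsBounce Ω p q from h)]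
  exact Exists.choose_spec _

theorem IsBounce.billiardMap_eq (h : IsBounce Ω p q) : billiardMap Ω p = q :=
  (isBounce_billiardMap h.mem_domain).unique h

/-- Thanks to the default value `p`, this holds on all of `M°`, so compositions need no restriction
of domain. -/
theorem mapsTo_billiardMap_phaseInterior :
    MapsTo (billiardMap Ω) (phaseInterior Ω) (phaseInterior Ω) := by
  intro p hp
  by_cases h : ∃ q, IsBounce Ω p q
  · exact (isBounce_billiardMap h).2.1
  · rwa [billiardMap, dif_neg h]

/-- Reversal at `q` undoes the reflection and leaves the velocity `-p.2`; the same segment is then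
traversed backwards, with time `s` replaced by `t - s`. -/
theorem IsBounce.reverse (hΩ : HasSmoothBoundary Ω) (h : IsBounce Ω p q) :
    IsBounce Ω (timeReversal Ω q) (timeReversal Ω p) := by
  obtain ⟨hp, hq, ⟨t, ht, hqt, hfree⟩, hw⟩ := h
  have hn := hΩ.norm_inwardNormal hq.1
  have hrev : (timeReversal Ω q).2 = -p.2 := by
    simp only [timeReversal]
    rw [hw, reflect_reflect hn]
  refine ⟨timeReversal_mem hΩ hq, timeReversal_mem hΩ hp, ⟨t, ht, ?_, fun s hs => ?_⟩, ?_⟩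
  · rw [hrev]
    change p.1 = q.1 + t • -p.2
    rw [hqt]
    module
  · rw [hrev]
    change q.1 + s • -p.2 ∉ frontier Ω
    rw [hqt, show p.1 + t • p.2 + s • -p.2 = p.1 + (t - s) • p.2 by module]
    exact hfree _ ⟨by linarith [hs.2], by linarith [hs.1]⟩
  · rw [hrev]
    simp only [timeReversal]
    rw [inner_neg_left, mul_neg, neg_smul, neg_sub, sub_neg_eq_add]
    abel

/-- Two bounces with the same end become, after reversal, two bounces with the same start, and these
have the same end. -/
theorem injOn_billiardMap (hΩ : HasSmoothBoundary Ω) :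
    InjOn (billiardMap Ω) (billiardDomain Ω) := by
  intro p hp p' hp' h
  have h1 := isBounce_billiardMap hp
  have h2 := isBounce_billiardMap hp'
  rw [← h] at h2
  rw [← timeReversal_timeReversal hΩ h1.1.1, (h1.reverse hΩ).unique (h2.reverse hΩ),
    timeReversal_timeReversal hΩ h2.1.1]

theorem IsBounce.invFunOn_eq (hΩ : HasSmoothBoundary Ω) (h : IsBounce Ω p q) :
    Function.invFunOn (billiardMap Ω) (billiardDomain Ω) q = p := by
  rw [← h.billiardMap_eq]
  exact (injOn_billiardMap hΩ).leftInvOn_invFunOn h.mem_domain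

/-- The inverse is conjugate to the billiard map by time reversal. -/
theorem isBounce_of_timeReversal_mem (hΩ : HasSmoothBoundary Ω) (hq : q ∈ phaseInterior Ω)
    (h : timeReversal Ω q ∈ billiardDomain Ω) :
    IsBounce Ω (timeReversal Ω (billiardMap Ω (timeReversal Ω q))) q := by
  have := (isBounce_billiardMap h).reverse hΩ
  rwa [timeReversal_timeReversal hΩ hq.1] at this

end Bounce

/-! ### Smoothness of the billiard map and of its inverse -/

section Smoothness

variable {Ω : Set Plane} {p q : Plane × Plane}

theorem inner_continuousOn_phaseInterior (hΩ : HasSmoothBoundary Ω) :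
    ContinuousOn (fun p : Plane × Plane => inner ℝ p.2 (inwardNormal Ω p.1))
      (phaseInterior Ω) :=
  continuousOn_snd.inner (hΩ.continuousOn_inwardNormal.comp continuousOn_fst fun _ h => h.1)

theorem contDiffWithinAt_timeReversal (hΩ : HasSmoothBoundary Ω) (hp : p ∈ phaseInterior Ω) :
    ContDiffWithinAt ℝ ∞ (timeReversal Ω) (phaseInterior Ω) p := by
  obtain ⟨f, hf⟩ := hΩ p.1 hp.1
  have hN : ContDiffAt ℝ ∞ (fun z : Plane × Plane => normalField f z.1) p :=
    hf.contDiffAt_normalField.comp p contDiffAt_fst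
  have hs : ContDiffAt ℝ ∞ (fun z : Plane × Plane =>
      (z.1, -(z.2 - (2 * inner ℝ z.2 (normalField f z.1)) • normalField f z.1))) p :=
    contDiffAt_fst.prodMk
      (contDiffAt_snd.sub ((contDiffAt_const.mul (contDiffAt_snd.inner ℝ hN)).smul hN)).neg
  refine hs.contDiffWithinAt.congr_of_eventuallyEq ?_ ?_
  · filter_upwards [self_mem_nhdsWithin, mem_nhdsWithin_of_mem_nhds
      ((continuous_fst.tendsto p).eventually hf.eventually_inwardNormal_eq)] with z h1 h2
    rw [timeReversal, h2 h1.1]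
  · rw [timeReversal, hf.inwardNormal_eq hp.1]

/-- Near a bounce, the billiard map is given by smooth formulas on an open set. -/
theorem IsBounce.exists_smooth_extension (hΩ : HasSmoothBoundary Ω) (h : IsBounce Ω p q) :
    ∃ (f : Plane → ℝ) (T : Plane × Plane → ℝ), IsLocalDefiningFunction Ω q.1 f ∧
      ContDiffAt ℝ ∞ T p ∧ 0 < T p ∧ q.1 = p.1 + T p • p.2 ∧
      (∀ᶠ z in 𝓝 p, f (z.1 + T z • z.2) = 0) ∧
      ∀ᶠ z in 𝓝[phaseInterior Ω] p, IsBounce Ω z (z.1 + T z • z.2,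
        z.2 - (2 * inner ℝ z.2 (normalField f (z.1 + T z • z.2))) •
          normalField f (z.1 + T z • z.2)) := by
  obtain ⟨hp, hq, ⟨t, ht, hqt, hfree⟩, hw⟩ := h
  have hn := hΩ.norm_inwardNormal hq.1
  obtain ⟨f, hf⟩ := hΩ q.1 hq.1
  have hneg : inner ℝ p.2 (inwardNormal Ω q.1) < 0 := by
    have := hq.2.2
    rw [hw, inner_reflect hn] at this
    linarith
  obtain ⟨T, hT, hTp, hTev⟩ := hΩ.exists_smooth_hitting_time (ρ := p) (s₀ := t) (hqt ▸ hq.1)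
    (by rw [← hqt]; exact hneg.ne)
  -- The ray also meets the boundary transversally at its starting point. Local uniqueness there
  -- excludes further hits at small positive times.
  obtain ⟨T', -, -, hTev'⟩ := hΩ.exists_smooth_hitting_time (ρ := p) (s₀ := 0)
    (by simpa using hp.1) (by simpa using hp.2.2.ne')
  have hpair : Tendsto (fun z => (z, T z)) (𝓝 p) (𝓝 (p, t)) := by
    have := (continuousAt_id (x := p)).prodMk hT.continuousAt
    rw [← hTp]
    exact this
  have hpair' : Tendsto (fun z : Plane × Plane => (z, (0 : ℝ))) (𝓝 p) (𝓝 (p, 0)) :=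
    (Continuous.prodMk_left (0 : ℝ)).tendsto p
  have hx : Tendsto (fun z => z.1 + T z • z.2) (𝓝 p) (𝓝 q.1) := by
    have : ContinuousAt (fun z => z.1 + T z • z.2) p :=
      continuousAt_fst.add (hT.continuousAt.smul continuousAt_snd)
    rw [hqt, ← hTp]
    exact this
  have hhit : ∀ᶠ z in 𝓝 p, z.1 + T z • z.2 ∈ frontier Ω := by
    filter_upwards [hpair.eventually hTev] with z hz
    exact hz.2 rfl
  have hTt : Tendsto T (𝓝 p) (𝓝 t) := hTp ▸ hT.continuousAt.tendsto
  -- No hit before `T z`, uniformly near `p`: by compactness of `[0, t + 1]` it suffices to argue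
  -- near each time `s`. At `0` and at `t` use uniqueness of the transversal hit, in between
  -- closedness of the boundary; beyond `t` the condition is vacuous. Any right end point above `t`
  -- would do, since it only has to exceed `T z` near `p`.
  have hfreeEv : ∀ᶠ z in 𝓝 p, ∀ s ∈ Icc 0 (t + 1), z ∈ phaseInterior Ω → 0 < s → s < T z →
      z.1 + s • z.2 ∉ frontier Ω := by
    refine isCompact_Icc.eventually_forall_of_forall_eventually fun s hs => ?_
    have hfst : Tendsto Prod.fst (𝓝 (p, s)) (𝓝 p) := continuous_fst.tendsto (p, s)
    have hsnd : Tendsto Prod.snd (𝓝 (p, s)) (𝓝 s) := continuous_snd.tendsto (p, s)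
    rcases lt_trichotomy s t with hst | rfl | hst
    · rcases hs.1.eq_or_lt with rfl | hs0
      · filter_upwards [hTev', hfst.eventually (hpair'.eventually hTev')] with z h1 h2 hz hz0 _ hmem
        have h3 : T' z.1 = 0 := h2.1 (by simpa using hz.1)
        exact hz0.ne (h3.symm.trans (h1.1 hmem))
      · have hcl : (frontier Ω)ᶜ ∈ 𝓝 (p.1 + s • p.2) :=
          isClosed_frontier.isOpen_compl.mem_nhds (hfree s ⟨hs0, hst⟩)
        have hcont : Continuous fun z : (Plane × Plane) × ℝ => z.1.1 + z.2 • z.1.2 := by fun_prop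
        filter_upwards [(hcont.tendsto (p, s)).eventually hcl] with z h1 _ _ _
        exact h1
    · filter_upwards [hTev] with z h1 _ _ hlt hmem
      exact hlt.ne (h1.1 hmem).symm
    · obtain ⟨c, hc1, hc2⟩ := exists_between hst
      filter_upwards [hfst.eventually (hTt.eventually_lt_const hc1), hsnd.eventually_const_lt hc2]
        with z h1 h2 _ _ h3
      linarith
  have hnegEv : ∀ᶠ z in 𝓝 p, inner ℝ z.2 (normalField f (z.1 + T z • z.2)) < 0 := by
    have h1 : Tendsto (fun z : Plane × Plane => inner ℝ z.2 (normalField f (z.1 + T z • z.2))) (𝓝 p)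
        (𝓝 (inner ℝ p.2 (normalField f q.1))) :=
      (continuous_snd.tendsto p).inner (hf.contDiffAt_normalField.continuousAt.tendsto.comp hx)
    rw [← hf.inwardNormal_eq hq.1] at h1
    exact h1.eventually_lt_const hneg
  refine ⟨f, T, hf, hT, hTp ▸ ht, hTp ▸ hqt, ?_, ?_⟩
  · filter_upwards [hhit, hx.eventually hf.eventually_mem_frontier_iff] with z h1 h2
    exact h2.1 h1
  · filter_upwards [self_mem_nhdsWithin, mem_nhdsWithin_of_mem_nhds hhit,
      mem_nhdsWithin_of_mem_nhds (hx.eventually hf.eventually), mem_nhdsWithin_of_mem_nhds hfreeEv,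
      mem_nhdsWithin_of_mem_nhds hnegEv,
      mem_nhdsWithin_of_mem_nhds (hTt.eventually_const_lt ht),
      mem_nhdsWithin_of_mem_nhds (hTt.eventually_lt_const (lt_add_one t))]
      with z hz h1 h2 h3 h4 h5 h6
    have h7 := h2.inwardNormal_eq h1
    refine ⟨hz, ⟨h1, norm_reflect h2.norm_normalField hz.2.1, ?_⟩, ⟨T z, h5, rfl, fun s hs => ?_⟩,
      by simp only [h7]⟩
    · simp only [h7]
      rw [inner_reflect h2.norm_normalField]
      linarith
    · exact h3 s ⟨hs.1.le, by linarith [hs.2]⟩ hz hs.1 hs.2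

theorem contDiffAt_reflected_ray {f : Plane → ℝ} {T : Plane × Plane → ℝ}
    (hf : IsLocalDefiningFunction Ω (p.1 + T p • p.2) f) (hT : ContDiffAt ℝ ∞ T p) :
    ContDiffAt ℝ ∞ (fun z : Plane × Plane => (z.1 + T z • z.2,
        z.2 - (2 * inner ℝ z.2 (normalField f (z.1 + T z • z.2))) •
          normalField f (z.1 + T z • z.2))) p := by
  have hx : ContDiffAt ℝ ∞ (fun z : Plane × Plane => z.1 + T z • z.2) p :=
    contDiffAt_fst.add (hT.smul contDiffAt_snd)
  have hN : ContDiffAt ℝ ∞ (fun z : Plane × Plane => normalField f (z.1 + T z • z.2)) p :=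
    ContDiffAt.comp (g := normalField f) p hf.contDiffAt_normalField hx
  exact hx.prodMk (contDiffAt_snd.sub ((contDiffAt_const.mul (contDiffAt_snd.inner ℝ hN)).smul hN))

theorem contDiffWithinAt_billiardMap (hΩ : HasSmoothBoundary Ω) (h : p ∈ billiardDomain Ω) :
    ContDiffWithinAt ℝ ∞ (billiardMap Ω) (phaseInterior Ω) p := by
  have hb := isBounce_billiardMap h
  obtain ⟨f, T, hf, hT, -, hq, -, hev⟩ := hb.exists_smooth_extension hΩ
  rw [hq] at hf
  refine (contDiffAt_reflected_ray hf hT).contDiffWithinAt.congr_of_eventuallyEq ?_ ?_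
  · exact hev.mono fun z hz => hz.billiardMap_eq
  · exact (hev.self_of_nhdsWithin hb.1).billiardMap_eq

theorem billiardDomain_mem_nhdsWithin (hΩ : HasSmoothBoundary Ω) (h : p ∈ billiardDomain Ω) :
    billiardDomain Ω ∈ 𝓝[phaseInterior Ω] p := by
  obtain ⟨f, T, -, -, -, -, -, hev⟩ := (isBounce_billiardMap h).exists_smooth_extension hΩ
  exact hev.mono fun z hz => hz.mem_domain

theorem IsBounce.eventually_timeReversal_mem (hΩ : HasSmoothBoundary Ω) (h : IsBounce Ω p q) :
    ∀ᶠ z in 𝓝[phaseInterior Ω] q, timeReversal Ω z ∈ billiardDomain Ω := by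
  have h1 : Tendsto (timeReversal Ω) (𝓝[phaseInterior Ω] q)
      (𝓝[phaseInterior Ω] (timeReversal Ω q)) :=
    tendsto_nhdsWithin_iff.2 ⟨(contDiffWithinAt_timeReversal hΩ h.2.1).continuousWithinAt,
      eventually_mem_nhdsWithin.mono fun z hz => timeReversal_mem hΩ hz⟩
  exact h1.eventually (billiardDomain_mem_nhdsWithin hΩ (h.reverse hΩ).mem_domain)

theorem IsBounce.eventually_isBounce_inv (hΩ : HasSmoothBoundary Ω) (h : IsBounce Ω p q) :
    ∀ᶠ z in 𝓝[phaseInterior Ω] q,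
      IsBounce Ω (timeReversal Ω (billiardMap Ω (timeReversal Ω z))) z := by
  filter_upwards [h.eventually_timeReversal_mem hΩ, self_mem_nhdsWithin] with z h1 h2
  exact isBounce_of_timeReversal_mem hΩ h2 h1

theorem IsBounce.image_mem_nhdsWithin (hΩ : HasSmoothBoundary Ω) (h : IsBounce Ω p q) :
    billiardMap Ω '' billiardDomain Ω ∈ 𝓝[phaseInterior Ω] q := by
  filter_upwards [h.eventually_isBounce_inv hΩ] with z hz
  exact ⟨_, hz.mem_domain, hz.billiardMap_eq⟩

theorem IsBounce.contDiffWithinAt_invFunOn (hΩ : HasSmoothBoundary Ω) (h : IsBounce Ω p q) :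
    ContDiffWithinAt ℝ ∞ (Function.invFunOn (billiardMap Ω) (billiardDomain Ω))
      (phaseInterior Ω) q := by
  have hr : MapsTo (timeReversal Ω) (phaseInterior Ω) (phaseInterior Ω) :=
    fun z hz => timeReversal_mem hΩ hz
  have h1 : ContDiffWithinAt ℝ ∞ (billiardMap Ω ∘ timeReversal Ω) (phaseInterior Ω) q :=
    (contDiffWithinAt_billiardMap hΩ (h.reverse hΩ).mem_domain).comp q
      (contDiffWithinAt_timeReversal hΩ h.2.1) hr
  have h2 : ContDiffWithinAt ℝ ∞ (timeReversal Ω ∘ (billiardMap Ω ∘ timeReversal Ω))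
      (phaseInterior Ω) q :=
    (contDiffWithinAt_timeReversal hΩ (mapsTo_billiardMap_phaseInterior (hr h.2.1))).comp q
      h1 (mapsTo_billiardMap_phaseInterior.comp hr)
  have h3 : ∀ᶠ z in 𝓝[phaseInterior Ω] q,
      Function.invFunOn (billiardMap Ω) (billiardDomain Ω) z =
        (timeReversal Ω ∘ (billiardMap Ω ∘ timeReversal Ω)) z :=
    (h.eventually_isBounce_inv hΩ).mono fun z hz => hz.invFunOn_eq hΩ
  exact h2.congr_of_eventuallyEq h3 (h3.self_of_nhdsWithin h.2.1)

end Smoothness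

end Billiard

namespace Billiard

/-! ### A frame of the tangent planes of the phase space -/

section Frame

variable {Ω : Set Plane} {p q : Plane × Plane}

/-- The variation of the base point, normalized to move the outgoing ray at unit speed. -/
noncomputable def frameBase (Ω : Set Plane) (p : Plane × Plane) : Plane × Plane :=
  ((inner ℝ p.2 (inwardNormal Ω p.1))⁻¹ • rot (inwardNormal Ω p.1), 0)

/-- The variation of the direction at unit speed. -/
noncomputable def frameAngle (p : Plane × Plane) : Plane × Plane := (0, rot p.2)

theorem inner_rot_rot (v w : Plane) : inner ℝ (rot v) (rot w) = inner ℝ v w := by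
  simp only [inner_eq_coords, rot_zero_coord, rot_one_coord]; ring

theorem inner_rot_self (v : Plane) : inner ℝ (rot v) v = 0 := by
  simp only [inner_eq_coords, rot_zero_coord, rot_one_coord]; ring

/-- Move the base point along a boundary curve with the direction fixed. Negative curvature serves
here only to supply a genuine unit speed parametrization. -/
theorem frameBase_mem_embTangentSpace (hΩ : HasSmoothBoundary Ω) (hp : p ∈ phaseInterior Ω)
    (hk : boundaryCurvature Ω p.1 < 0) :
    frameBase Ω p ∈ embTangentSpace (phaseInterior Ω) p := by
  obtain ⟨f, hf⟩ := hΩ p.1 hp.1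
  obtain ⟨γ, τ, h0, hγ, hev, hτ, hτn, -⟩ := hf.exists_curve hp.1 (isBoundaryCurvature_of_neg hk)
  have hγt : Tendsto γ (𝓝 0) (𝓝 p.1) := by
    have := hγ.continuousAt.tendsto
    rwa [h0] at this
  have hpos : ∀ᶠ y in 𝓝 p.1, 0 < inner ℝ p.2 (normalField f y) := by
    have h1 : Tendsto (fun y => inner ℝ p.2 (normalField f y)) (𝓝 p.1)
        (𝓝 (inner ℝ p.2 (normalField f p.1))) :=
      tendsto_const_nhds.inner hf.contDiffAt_normalField.continuousAt.tendsto
    refine h1.eventually_const_lt ?_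
    rw [← hf.inwardNormal_eq hp.1]
    exact hp.2.2
  have hmem : ((τ, 0) : Plane × Plane) ∈ embTangentSpace (phaseInterior Ω) p := by
    refine HasDerivAt.mem_embTangentSpace (γ := fun s => (γ s, p.2))
      (hγ.prodMk (hasDerivAt_const (0 : ℝ) p.2)) (Prod.ext h0 rfl) ?_
    filter_upwards [hev, hγt.eventually hpos, hγt.eventually hf.eventually_inwardNormal_eq]
      with s h1 h2 h3
    refine ⟨h1, hp.2.1, ?_⟩
    rw [h3 h1]
    exact h2
  have h1 := eq_smul_rot_of_inner_eq_zero hf.norm_normalField hτn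
  set b := inner ℝ τ (rot (normalField f p.1))
  have hb : b ≠ 0 := by
    intro hb
    rw [hb, zero_smul] at h1
    rw [h1, norm_zero] at hτ
    exact zero_ne_one hτ
  have h2 : frameBase Ω p = ((inner ℝ p.2 (inwardNormal Ω p.1))⁻¹ * b⁻¹) • (τ, 0) := by
    rw [frameBase, hf.inwardNormal_eq hp.1, Prod.smul_mk, smul_zero, mul_smul]
    conv_rhs => rw [h1, inv_smul_smul₀ hb]
  rw [h2]
  exact Submodule.smul_mem _ _ hmem

theorem frameAngle_mem_embTangentSpace (hp : p ∈ phaseInterior Ω) :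
    frameAngle p ∈ embTangentSpace (phaseInterior Ω) p := by
  have hd : HasDerivAt (fun s : ℝ => Real.cos s • p.2 + Real.sin s • rot p.2) (rot p.2) 0 := by
    have h := ((Real.hasDerivAt_cos 0).smul_const p.2).fun_add
      ((Real.hasDerivAt_sin 0).smul_const (rot p.2))
    simpa using h
  refine HasDerivAt.mem_embTangentSpace
    (γ := fun s : ℝ => (p.1, Real.cos s • p.2 + Real.sin s • rot p.2))
    ((hasDerivAt_const (0 : ℝ) p.1).prodMk hd) (by simp) ?_
  have hpos : ∀ᶠ s : ℝ in 𝓝 0,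
      0 < inner ℝ (Real.cos s • p.2 + Real.sin s • rot p.2) (inwardNormal Ω p.1) := by
    have h1 := hd.continuousAt.tendsto.inner (𝕜 := ℝ) (tendsto_const_nhds (x := inwardNormal Ω p.1))
    refine h1.eventually_const_lt ?_
    simpa using hp.2.2
  filter_upwards [hpos] with s hs
  refine ⟨hp.1, ?_, hs⟩
  have h1 := coords_of_norm_eq_one hp.2.1
  apply norm_eq_one_of_coords
  simp only [PiLp.add_apply, PiLp.smul_apply, smul_eq_mul, rot_zero_coord, rot_one_coord]
  linear_combination (Real.cos s ^ 2 + Real.sin s ^ 2) * h1 + Real.cos_sq_add_sin_sq s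

/-- The equations `f x = 0` and `|w|² = 1` hold on `M°` near `p`, so their differentials vanish on
tangent vectors. -/
theorem inner_eq_zero_of_mem_embTangentSpace (hΩ : HasSmoothBoundary Ω)
    (hp : p ∈ phaseInterior Ω) {v : Plane × Plane}
    (hv : v ∈ embTangentSpace (phaseInterior Ω) p) :
    inner ℝ v.1 (inwardNormal Ω p.1) = 0 ∧ inner ℝ v.2 p.2 = 0 := by
  constructor
  · obtain ⟨f, hf⟩ := hΩ p.1 hp.1
    have h1 : HasFDerivAt (fun z : Plane × Plane => f z.1)
        ((fderiv ℝ f p.1).comp (ContinuousLinearMap.fst ℝ Plane Plane)) p :=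
      (hf.smooth.differentiable (by simp) p.1).hasFDerivAt.comp p hasFDerivAt_fst
    have h2 := h1.hasFDerivWithinAt.eq_zero_of_eventually_const (M := phaseInterior Ω) (c := 0)
      (by
        filter_upwards [self_mem_nhdsWithin, mem_nhdsWithin_of_mem_nhds
          ((continuous_fst.tendsto p).eventually hf.eventually_mem_frontier_iff)] with z h1 h2
        exact h2.1 h1.1)
      (hf.mem_frontier_iff.1 hp.1) hv
    rw [ContinuousLinearMap.comp_apply, ContinuousLinearMap.coe_fst',
      fderiv_eq_inner_normalField] at h2
    rw [hf.inwardNormal_eq hp.1, real_inner_comm]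
    exact (mul_eq_zero.1 h2).resolve_left (norm_ne_zero_iff.2 hf.gradient_ne_zero)
  · have h1 : HasFDerivAt (fun z : Plane × Plane => z.2)
        (ContinuousLinearMap.snd ℝ Plane Plane) p := hasFDerivAt_snd
    have h2 := (h1.inner ℝ h1).hasFDerivWithinAt.eq_zero_of_eventually_const
      (M := phaseInterior Ω) (c := 1)
      (by
        filter_upwards [self_mem_nhdsWithin] with z hz
        rw [real_inner_self_eq_norm_sq, hz.2.1, one_pow])
      (by rw [real_inner_self_eq_norm_sq, hp.2.1, one_pow]) hv
    simp only [ContinuousLinearMap.comp_apply, ContinuousLinearMap.prod_apply,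
      fderivInnerCLM_apply, ContinuousLinearMap.coe_snd'] at h2
    rw [real_inner_comm] at h2
    linarith

theorem embTangentSpace_phaseInterior (hΩ : HasSmoothBoundary Ω) (hp : p ∈ phaseInterior Ω)
    (hk : boundaryCurvature Ω p.1 < 0) :
    embTangentSpace (phaseInterior Ω) p = Submodule.span ℝ {frameBase Ω p, frameAngle p} := by
  apply le_antisymm
  · intro v hv
    obtain ⟨h1, h2⟩ := inner_eq_zero_of_mem_embTangentSpace hΩ hp hv
    have h3 := eq_smul_rot_of_inner_eq_zero (hΩ.norm_inwardNormal hp.1) h1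
    have h4 := eq_smul_rot_of_inner_eq_zero hp.2.1 h2
    refine Submodule.mem_span_pair.2 ⟨inner ℝ v.1 (rot (inwardNormal Ω p.1)) *
      inner ℝ p.2 (inwardNormal Ω p.1), inner ℝ v.2 (rot p.2), ?_⟩
    refine Prod.ext ?_ ?_
    · simp only [frameBase, frameAngle, Prod.fst_add, Prod.smul_fst, smul_zero, add_zero]
      rw [smul_smul, mul_assoc, mul_inv_cancel₀ hp.2.2.ne', mul_one]
      exact h3.symm
    · simp only [frameBase, frameAngle, Prod.snd_add, Prod.smul_snd, smul_zero, zero_add]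
      exact h4.symm
  · rw [Submodule.span_le]
    rintro _ (rfl | rfl)
    · exact frameBase_mem_embTangentSpace hΩ hp hk
    · exact frameAngle_mem_embTangentSpace hp

theorem linearIndependent_frame (hΩ : HasSmoothBoundary Ω) (hp : p ∈ phaseInterior Ω) :
    LinearIndependent ℝ ![frameBase Ω p, frameAngle p] := by
  have h1 : rot (inwardNormal Ω p.1) ≠ 0 := by
    rw [← norm_ne_zero_iff, norm_rot, hΩ.norm_inwardNormal hp.1]; exact one_ne_zero
  have h2 : rot p.2 ≠ 0 := by
    rw [← norm_ne_zero_iff, norm_rot, hp.2.1]; exact one_ne_zero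
  refine LinearIndependent.pair_iff.2 fun s t h => ?_
  simp only [frameBase, frameAngle, Prod.smul_mk, Prod.mk_add_mk, smul_zero, add_zero,
    zero_add, Prod.mk_eq_zero, smul_eq_zero, inv_eq_zero, h1, h2, hp.2.2.ne', or_false] at h
  exact h

end Frame

/-! ### The differential of the billiard map -/

section Differential

variable {Ω : Set Plane} {p q : Plane × Plane}

theorem IsBounce.norm_sub (h : IsBounce Ω p q) {T : ℝ} (hT : 0 < T) (hq : q.1 = p.1 + T • p.2) :
    ‖q.1 - p.1‖ = T := by
  rw [hq, add_sub_cancel_left, norm_smul, h.1.2.1, mul_one, Real.norm_of_nonneg hT.le]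

/-- Differentiate the formulas for the hit point and the reflected direction. The variation of the
flight time enters `ξ` only through the multiple `c` of `p.2`; `ξ` is tangent to the boundary, hence
the normal varies by `-k ξ`. -/
theorem IsBounce.exists_fderivWithin_eq (hΩ : HasSmoothBoundary Ω) (h : IsBounce Ω p q) {k : ℝ}
    (hk : IsBoundaryCurvature Ω q.1 k) {v : Plane × Plane}
    (hv : v ∈ embTangentSpace (phaseInterior Ω) p) :
    ∃ (c : ℝ) (ξ : Plane), ξ = v.1 + ‖q.1 - p.1‖ • v.2 + c • p.2 ∧
      inner ℝ ξ (inwardNormal Ω q.1) = 0 ∧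
      fderivWithin ℝ (billiardMap Ω) (phaseInterior Ω) p v =
        (ξ, v.2 - (2 * (inner ℝ v.2 (inwardNormal Ω q.1) - k * inner ℝ p.2 ξ)) •
          inwardNormal Ω q.1 + (2 * k * inner ℝ p.2 (inwardNormal Ω q.1)) • ξ) := by
  obtain ⟨f, T, hf, hT, hT0, hq, hfz, hev⟩ := h.exists_smooth_extension hΩ
  have hn := hf.inwardNormal_eq h.2.1.1
  have hTd := (hT.differentiableAt (by simp)).hasFDerivAt
  have hfst : HasFDerivAt (fun z : Plane × Plane => z.1)
        (ContinuousLinearMap.fst ℝ Plane Plane) p := hasFDerivAt_fst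
  have hsnd : HasFDerivAt (fun z : Plane × Plane => z.2)
        (ContinuousLinearMap.snd ℝ Plane Plane) p := hasFDerivAt_snd
  have hX := hfst.add (hTd.smul hsnd)
  set X' := ContinuousLinearMap.fst ℝ Plane Plane + (T p • ContinuousLinearMap.snd ℝ Plane Plane +
    (fderiv ℝ T p).smulRight p.2) with hX'
  have hXv : X' v = v.1 + ‖q.1 - p.1‖ • v.2 + (fderiv ℝ T p v) • p.2 := by
    rw [h.norm_sub hT0 hq]
    simp [hX', add_assoc]
  have htan : inner ℝ (X' v) (normalField f q.1) = 0 := by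
    have h1 : HasFDerivAt f (fderiv ℝ f q.1) (p.1 + T p • p.2) := by
      rw [← hq]; exact (hf.smooth.differentiable (by simp) q.1).hasFDerivAt
    have h2 := (HasFDerivAt.comp p h1 hX).unique
      ((hasFDerivAt_const (0 : ℝ) p).congr_of_eventuallyEq hfz)
    have h3 := congrArg (fun L => L v) h2
    simp only [ContinuousLinearMap.comp_apply, fderiv_eq_inner_normalField] at h3
    rw [real_inner_comm]
    exact (mul_eq_zero.1 h3).resolve_left (norm_ne_zero_iff.2 hf.gradient_ne_zero)
  have hN : HasFDerivAt (fun z : Plane × Plane => normalField f (z.1 + T z • z.2))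
      ((fderiv ℝ (normalField f) q.1).comp X') p := by
    have h1 : HasFDerivAt (normalField f) (fderiv ℝ (normalField f) q.1) (p.1 + T p • p.2) := by
      rw [← hq]; exact (hf.contDiffAt_normalField.differentiableAt (by simp)).hasFDerivAt
    exact HasFDerivAt.comp (g := normalField f) p h1 hX
  have hNv : fderiv ℝ (normalField f) q.1 (X' v) = (-k) • X' v :=
    hf.fderiv_normalField_of_tangent h.2.1.1 hk htan
  have hΦ := hX.prodMk (hsnd.sub (((hsnd.inner ℝ hN).const_mul 2).smul hN))
  have hφ := hΦ.hasFDerivWithinAt.congr_of_eventuallyEq (s := phaseInterior Ω)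
    (f₁ := billiardMap Ω) (hev.mono fun z hz => hz.billiardMap_eq)
    (hev.self_of_nhdsWithin h.1).billiardMap_eq
  refine ⟨_, X' v, hXv, hn ▸ htan, ?_⟩
  rw [hφ.differentiableWithinAt.hasFDerivWithinAt.eqOn_embTangentSpace hφ hv, hn]
  refine Prod.ext rfl ?_
  simp [← hq, hNv, inner_smul_right, fderivInnerCLM_apply]
  module

/-- The reflection of an infinitesimal beam off a curved wall. -/
theorem reflect_beam {n w ξ : Plane} {k c j j' : ℝ} (hn : ‖n‖ = 1)
    (hc : inner ℝ (w - (2 * inner ℝ w n) • n) n = c) (hc0 : c ≠ 0) (hξ : inner ℝ ξ n = 0)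
    (hj : inner ℝ ξ (rot w) = j) :
    ξ = -(j • c⁻¹ • rot n) ∧
    j' • rot w - (2 * (inner ℝ (j' • rot w) n - k * inner ℝ w ξ)) • n + (2 * k * inner ℝ w n) • ξ =
      -((j' + -(2 * k / c) * j) • rot (w - (2 * inner ℝ w n) • n)) := by
  rw [inner_reflect hn] at hc
  have h1 := eq_smul_rot_of_inner_eq_zero hn hξ
  set b := inner ℝ ξ (rot n)
  -- Reflection flips the normal component, so `⟨w, n⟩ = -c`; pairing `ξ = b rot n` with `rot w`
  -- gives `j = -b c`.
  have hb : b = -(j * c⁻¹) := by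
    rw [h1, real_inner_smul_left, inner_rot_rot, real_inner_comm] at hj
    rw [← hj, ← hc]
    rw [← hc] at hc0
    field_simp [neg_ne_zero.1 hc0]
  have hjc : -(2 * k / c) * j = 2 * k * b := by rw [hb]; ring
  refine ⟨by rw [h1, hb, smul_smul, neg_smul], ?_⟩
  rw [hjc, h1]
  have h2 := coords_of_norm_eq_one hn
  apply Plane.ext <;>
    simp only [inner_eq_coords, PiLp.add_apply, PiLp.sub_apply, PiLp.neg_apply, PiLp.smul_apply,
      smul_eq_mul, rot_zero_coord, rot_one_coord]
  · linear_combination (2 * (j' + k * b) * w 1) * h2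
  · linear_combination (-2 * (j' + k * b) * w 0) * h2

/-- Flight adds `‖q.1 - p.1‖ * j'` to the displacement `j`, then the curved wall adds a multiple of
the new displacement to the rotation `j'`. The overall sign appears because a reflection reverses
orientation while `rot` does not. -/
theorem IsBounce.fderivWithin_frame (hΩ : HasSmoothBoundary Ω) (h : IsBounce Ω p q) {k : ℝ}
    (hk : IsBoundaryCurvature Ω q.1 k) {v : Plane × Plane} {j j' : ℝ}
    (hv : v ∈ embTangentSpace (phaseInterior Ω) p) (hj : inner ℝ v.1 (rot p.2) = j)
    (hj' : v.2 = j' • rot p.2) :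
    fderivWithin ℝ (billiardMap Ω) (phaseInterior Ω) p v =
      -((j + ‖q.1 - p.1‖ * j') • frameBase Ω q +
        (j' + -(2 * k / inner ℝ q.2 (inwardNormal Ω q.1)) * (j + ‖q.1 - p.1‖ * j')) •
          frameAngle q) := by
  obtain ⟨c, ξ, hξ, hξn, hd⟩ := h.exists_fderivWithin_eq hΩ hk hv
  have hw : ‖p.2‖ = 1 := h.1.2.1
  -- Pairing with `rot p.2` removes the unknown multiple `c` of `p.2`.
  have hJ : inner ℝ ξ (rot p.2) = j + ‖q.1 - p.1‖ * j' := by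
    rw [hξ, inner_add_left, inner_add_left, hj, hj', real_inner_smul_left, real_inner_smul_left,
      real_inner_smul_left, real_inner_self_eq_norm_sq, norm_rot, hw, real_inner_comm,
      inner_rot_self]
    ring
  have hq2 := h.2.2.2
  obtain ⟨h1, h2⟩ := reflect_beam (k := k) (j' := j') (hΩ.norm_inwardNormal h.2.1.1)
    (congrArg (fun w => inner ℝ w (inwardNormal Ω q.1)) hq2.symm) h.2.1.2.2.ne' hξn hJ
  rw [← hq2, ← hj'] at h2
  rw [hd, h2]
  refine Prod.ext ?_ ?_
  · rw [h1]
    simp [frameBase, frameAngle]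
  · simp [frameBase, frameAngle]

end Differential

/-! ### The Euclidean metric in the frame -/

section Metric

/-- The Euclidean metric on the product of two planes. -/
noncomputable def euclideanMetric :
    Plane × Plane → Plane × Plane →L[ℝ] Plane × Plane →L[ℝ] ℝ := fun _ =>
  (innerSL ℝ).bilinearComp (ContinuousLinearMap.fst ℝ Plane Plane)
      (ContinuousLinearMap.fst ℝ Plane Plane) +
    (innerSL ℝ).bilinearComp (ContinuousLinearMap.snd ℝ Plane Plane)
      (ContinuousLinearMap.snd ℝ Plane Plane)

theorem euclideanMetric_apply (x u v : Plane × Plane) :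
    euclideanMetric x u v = inner ℝ u.1 v.1 + inner ℝ u.2 v.2 := rfl

theorem isRiemannianMetricOn_euclideanMetric (M : Set (Plane × Plane)) :
    IsRiemannianMetricOn M euclideanMetric where
  smooth := contDiffOn_const
  symm x _ u _ v _ := by
    rw [euclideanMetric_apply, euclideanMetric_apply, real_inner_comm, real_inner_comm u.2]
  pos x _ v _ hv := by
    rw [euclideanMetric_apply, real_inner_self_eq_norm_sq, real_inner_self_eq_norm_sq]
    rcases ne_or_eq v.1 0 with h | h
    · have := norm_pos_iff.2 h
      positivity
    · have := norm_pos_iff.2 fun h' => hv (Prod.ext h h')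
      positivity

theorem sqrt_euclideanMetric_frame {Ω : Set Plane} (hΩ : HasSmoothBoundary Ω) {p : Plane × Plane}
    (hp : p ∈ phaseInterior Ω) (β : ℝ) :
    √(euclideanMetric p (frameBase Ω p + β • frameAngle p) (frameBase Ω p + β • frameAngle p)) =
      √((inner ℝ p.2 (inwardNormal Ω p.1))⁻¹ ^ 2 + β ^ 2) := by
  rw [euclideanMetric_apply, real_inner_self_eq_norm_sq, real_inner_self_eq_norm_sq]
  simp only [frameBase, frameAngle, Prod.smul_mk, Prod.mk_add_mk, smul_zero, add_zero, zero_add,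
    norm_smul, norm_rot, hΩ.norm_inwardNormal hp.1, hp.2.1, mul_one, Real.norm_eq_abs, sq_abs]

/-- The two frame vectors are orthogonal, and the first has length `1 / ⟨w, n⟩ ≥ 1`. -/
theorem one_le_sqrt_euclideanMetric_frame {Ω : Set Plane} (hΩ : HasSmoothBoundary Ω)
    {p : Plane × Plane} (hp : p ∈ phaseInterior Ω) (β : ℝ) :
    1 ≤ √(euclideanMetric p (frameBase Ω p + β • frameAngle p)
      (frameBase Ω p + β • frameAngle p)) := by
  rw [sqrt_euclideanMetric_frame hΩ hp, Real.one_le_sqrt]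
  have h1 : inner ℝ p.2 (inwardNormal Ω p.1) ≤ 1 := by
    simpa [hp.2.1, hΩ.norm_inwardNormal hp.1] using real_inner_le_norm p.2 (inwardNormal Ω p.1)
  have h2 := one_le_pow₀ (n := 2) ((one_le_inv₀ hp.2.2).2 h1)
  nlinarith

theorem sqrt_euclideanMetric_frame_le {Ω : Set Plane} (hΩ : HasSmoothBoundary Ω)
    {p : Plane × Plane} (hp : p ∈ phaseInterior Ω) (β : ℝ) {c : ℝ} (hc : 0 < c)
    (hcp : c ≤ inner ℝ p.2 (inwardNormal Ω p.1)) :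
    √(euclideanMetric p (frameBase Ω p + β • frameAngle p)
      (frameBase Ω p + β • frameAngle p)) ≤ (c⁻¹ + 1) * (1 + |β|) := by
  rw [sqrt_euclideanMetric_frame hΩ hp]
  have h1 := inv_anti₀ hc hcp
  have h2 : 0 < (inner ℝ p.2 (inwardNormal Ω p.1))⁻¹ := inv_pos.2 hp.2.2
  have h3 : 0 < c⁻¹ := inv_pos.2 hc
  refine Real.sqrt_le_iff.2 ⟨by positivity, ?_⟩
  have h4 : (inner ℝ p.2 (inwardNormal Ω p.1))⁻¹ ^ 2 ≤ c⁻¹ ^ 2 := by gcongr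
  have h5 := abs_nonneg β
  rw [← sq_abs β]
  nlinarith [mul_nonneg h3.le h5, mul_nonneg (sq_nonneg c⁻¹) h5,
    mul_nonneg (mul_nonneg h3.le h5) h5, mul_nonneg (sq_nonneg c⁻¹) (sq_nonneg |β|)]

end Metric

end Billiard

/-! ### Uniform constants and the proof of the theorem -/

theorem IsCompact.exists_pos_forall_le {X : Type*} [TopologicalSpace X] {K : Set X}
    (hK : IsCompact K) {h : X → ℝ} (hc : ContinuousOn h K) (hpos : ∀ x ∈ K, 0 < h x) :
    ∃ c, 0 < c ∧ ∀ x ∈ K, c ≤ h x := by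
  rcases K.eq_empty_or_nonempty with rfl | hne
  · exact ⟨1, one_pos, by simp⟩
  · obtain ⟨x, hx, hmin⟩ := hK.exists_isMinOn hne hc
    exact ⟨h x, hpos x hx, fun y hy => hmin hy⟩

open Billiard in
theorem propositionl (Ω : Set Billiard.Plane) (hΩ : Billiard.HasSmoothBoundary Ω)
    (hcompact : IsCompact (frontier Ω))
    (𝒦 : Set (Billiard.Plane × Billiard.Plane))
    (h𝒦 : IsCompact 𝒦)
    (hdom : 𝒦 ⊆ Billiard.billiardDomain Ω)
    (hinv : Billiard.billiardMap Ω '' 𝒦 = 𝒦)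
    (hcurv : ∀ ρ ∈ 𝒦, Billiard.boundaryCurvature Ω ρ.1 < 0) :
    IsHyperbolicOn (Billiard.phaseInterior Ω) (Billiard.billiardDomain Ω)
      (Billiard.billiardMap Ω) 1 1 𝒦 := by
  have hb : ∀ x ∈ 𝒦, IsBounce Ω x (billiardMap Ω x) := fun x hx => isBounce_billiardMap (hdom hx)
  have hM : ∀ x ∈ 𝒦, x ∈ phaseInterior Ω := fun x hx => (hb x hx).1
  have hpre : ∀ x ∈ 𝒦, ∃ y ∈ 𝒦, IsBounce Ω y x := fun x hx => by
    obtain ⟨y, hy, rfl⟩ := hinv.ge hx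
    exact ⟨y, hy, hb y hy⟩
  have hsmooth : ∀ x ∈ 𝒦, ContDiffWithinAt ℝ ∞ (billiardMap Ω) (phaseInterior Ω) x :=
    fun x hx => contDiffWithinAt_billiardMap hΩ (hdom hx)
  have hsmooth' : ∀ x ∈ 𝒦, ContDiffWithinAt ℝ ∞
      (Function.invFunOn (billiardMap Ω) (billiardDomain Ω)) (phaseInterior Ω) x := fun x hx => by
    obtain ⟨y, -, hy⟩ := hpre x hx
    exact hy.contDiffWithinAt_invFunOn hΩ
  refine ⟨h𝒦, hdom, fun p hp => (isBounce_billiardMap hp).1,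
    fun p hp => (isBounce_billiardMap hp).2.1, hinv, injOn_billiardMap hΩ,
    fun x hx => billiardDomain_mem_nhdsWithin hΩ (hdom hx), fun x hx => ?_, hsmooth, hsmooth', ?_⟩
  · obtain ⟨y, -, hy⟩ := hpre x hx
    exact hy.image_mem_nhdsWithin hΩ
  have hφ : MapsTo (billiardMap Ω) 𝒦 𝒦 := mapsTo_iff_image_subset.2 hinv.le
  have hcont : ContinuousOn (billiardMap Ω) 𝒦 := fun x hx =>
    (hsmooth x hx).continuousWithinAt.mono hM
  have hcos : ContinuousOn (fun x : Plane × Plane => inner ℝ x.2 (inwardNormal Ω x.1)) 𝒦 :=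
    (inner_continuousOn_phaseInterior hΩ).mono hM
  have hkc : ContinuousOn (fun x : Plane × Plane => boundaryCurvature Ω x.1) 𝒦 :=
    hΩ.continuousOn_boundaryCurvature.comp continuousOn_fst
      fun x hx => ⟨(hM x hx).1, hcurv x hx⟩
  -- `t` is the length of the flight that starts at `x`, while `a` belongs to the reflection at `x`
  -- itself; the differential at `x` therefore involves `a` at the image point. Both are continuous
  -- and positive on the compact set.
  set t : Plane × Plane → ℝ := fun x => ‖(billiardMap Ω x).1 - x.1‖ with ht
  set a : Plane × Plane → ℝ := fun x =>
    -(2 * boundaryCurvature Ω x.1 / inner ℝ x.2 (inwardNormal Ω x.1)) with ha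
  have hac : ContinuousOn a 𝒦 :=
    ((continuousOn_const.mul hkc).div hcos fun x hx => (hM x hx).2.2.ne').neg
  obtain ⟨t₀, ht₀, ht'⟩ := h𝒦.exists_pos_forall_le (h := t)
    ((continuousOn_fst.comp hcont (mapsTo_univ _ _)).sub continuousOn_fst).norm fun x hx => by
      obtain ⟨-, -, ⟨s, hs, hqs, -⟩, -⟩ := hb x hx
      rw [ht]
      simp only
      rw [(hb x hx).norm_sub hs hqs]
      exact hs
  obtain ⟨a₀, ha₀, ha'⟩ := h𝒦.exists_pos_forall_le hac fun x hx =>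
    neg_pos.2 (div_neg_of_neg_of_pos (by linarith [hcurv x hx]) (hM x hx).2.2)
  obtain ⟨c, hc, hc'⟩ := h𝒦.exists_pos_forall_le hcos fun x hx => (hM x hx).2.2
  obtain ⟨a₁, ha₁⟩ := h𝒦.bddAbove_image hac
  have hc1 : 0 < c⁻¹ + 1 := by positivity
  refine exists_splitting_of_dispersing (e₁ := frameBase Ω) (e₂ := frameAngle) (t := t) (a := a)
    (isRiemannianMetricOn_euclideanMetric _) hφ (fun x hx => ?_) hM (fun x hx => ?_)
    (fun x hx => ?_) (fun x hx => ?_) (fun x hx => ?_)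
    (fun x hx => (hsmooth x hx).differentiableWithinAt (by simp))
    (fun x hx => (hsmooth' x hx).differentiableWithinAt (by simp))
    (fun x hx => embTangentSpace_phaseInterior hΩ (hM x hx) (hcurv x hx))
    (fun x hx => linearIndependent_frame hΩ (hM x hx)) (fun x hx => ?_) (fun x hx => ?_)
    ht₀ ht' ha₀ ha' (fun x hx => ha₁ (mem_image_of_mem a hx)) one_pos hc1
    (fun x hx β => one_le_sqrt_euclideanMetric_frame hΩ (hM x hx) β)
    (fun x hx β => sqrt_euclideanMetric_frame_le hΩ (hM x hx) β hc (hc' x hx))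
  · obtain ⟨y, hy, hyx⟩ := hpre x hx
    rwa [hyx.invFunOn_eq hΩ]
  · filter_upwards [billiardDomain_mem_nhdsWithin hΩ (hdom hx)] with y hy
    exact (isBounce_billiardMap hy).invFunOn_eq hΩ
  · obtain ⟨y, hy, hyx⟩ := hpre x hx
    rw [hyx.invFunOn_eq hΩ, hyx.billiardMap_eq]
  · exact eventually_mem_nhdsWithin.mono mapsTo_billiardMap_phaseInterior
  · obtain ⟨y, hy, hyx⟩ := hpre x hx
    filter_upwards [hyx.eventually_isBounce_inv hΩ] with z hz
    rw [hz.invFunOn_eq hΩ]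
    exact hz.1
  -- The frame vectors have coordinates `(j, j') = (1, 0)` and `(0, 1)`; the factor `1 / ⟨w, n⟩` in
  -- `frameBase` is what makes its displacement equal to one.
  · rw [(hb x hx).fderivWithin_frame hΩ (isBoundaryCurvature_of_neg (hcurv _ (hφ hx))) (j := 1)
      (j' := 0) (frameBase_mem_embTangentSpace hΩ (hM x hx) (hcurv x hx)) ?_ (by simp [frameBase])]
    · simp [ha]
    · simp only [frameBase]
      rw [real_inner_smul_left, inner_rot_rot, real_inner_comm x.2, inv_mul_cancel₀ (hM x hx).2.2.ne']
  · rw [(hb x hx).fderivWithin_frame hΩ (isBoundaryCurvature_of_neg (hcurv _ (hφ hx))) (j := 0)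
      (j' := 1) (frameAngle_mem_embTangentSpace (hM x hx)) (by simp [frameAngle])
      (by simp [frameAngle])]
    simp only [ha, ht]
    congr 3 <;> ring
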